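/- Let $\mathcal H$ be a complex Hilbert space (scalar product $(\cdot,\cdot)$ linear in the first argument) and let $H_0$ be a self-adjoint operator in $\mathcal H$ with a spectral gap $(-\delta,\delta)\subset\rho(H_0)$, $\delta>0$. Let $P_+$ and $P_-$ be the spectral projections of $H_0$ corresponding to its positive and negative spectrum, let $\mathcal Q:=\operatorname{dom}(|H_0|^{1/2})$, and let $\mathfrak h_0[u,w]:=(|H_0|^{1/2}u,\operatorname{sign}(H_0)|H_0|^{1/2}w)$ for $u,w\in\mathcal Q$. Let $\mathfrak v$ be a symmetric sesquilinear form whose domain $\operatorname{dom}(\mathfrak v)\subset\mathcal Q$ is a core for $|H_0|^{1/2}$, and suppose that $$\sup\bigl\{\,\bigl|\mathfrak v[|H_0|^{-1/2}x,|H_0|^{-1/2}y]\bigr| : \|x\|=\|y\|=1,\ |H_0|^{-1/2}x,\,|H_0|^{-1/2}y\in\operatorname{dom}(\mathfrak v)\bigr\}<\infty .$$ Then $\mathfrak v$ extends uniquely to a sesquilinear form on $\mathcal Q$ with finite supremum over all unit vectors $x,y\in\mathcal H$; denote the extension again by $\mathfrak v$. Suppose that $$\rho:=\sup\bigl\{\,\bigl|\mathfrak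 v[|H_0|^{-1/2}x,|H_0|^{-1/2}y]\bigr| : x,y\in P_+\mathcal H\cup P_-\mathcal H,\ \|x\|=\|y\|=1\bigr\}<1$$ (so $x$ and $y$ may lie in different subspaces; $\sup\emptyset:=0$). Let $\widetilde P_\pm$ be bounded, not necessarily orthogonal, projections with $\widetilde P_++\widetilde P_-=I$ such that $$\nu:=\|P_\pm-\widetilde P_\pm\|<1,\qquad \arctan\sqrt{\frac{\rho}{2-\rho}}+\arcsin\nu<\frac{\pi}{2}$$ (the two norms are equal). A closed densely defined operator $H$ is called associated with a form $\mathfrak h$ on $\mathcal Q$ if $\operatorname{dom}(H),\operatorname{dom}(H^*)\subset\mathcal Q$, $(Hu,w)=\mathfrak h[u,w]$ for $u\in\operatorname{dom}(H)$, $w\in\mathcal Q$, and $(u,H^*w)=\mathfrak h[u,w]$ for $u\in\mathcal Q$, $w\in\operatorname{dom}(H^*)$. Then the following hold. (i) There is a unique self-adjoint operator $H$ associated with $\mathfrak h:=\mathfrak h_0+\mathfrak v$; moreover $0\in\rho(H)$, and $\operatorname{dom}(H)$ is a core for $|H_0|^{1/2}$. (ii) Let $Q_\pm$ be the spectral projections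 of $H$ corresponding to its positive and negative spectrum. Then $\widetilde P_\pm|_{Q_\pm\mathcal H}:Q_\pm\mathcal H\to\widetilde P_\pm\mathcal H$ are linear homeomorphisms, and the bounded operators $X_\pm:=\widetilde P_\mp(\widetilde P_\pm|_{Q_\pm\mathcal H})^{-1}:\widetilde P_\pm\mathcal H\to\widetilde P_\mp\mathcal H$ satisfy $$Q_+\mathcal H=\{x+X_+x: x\in\widetilde P_+\mathcal H\},\qquad Q_-\mathcal H=\{y+X_-y: y\in\widetilde P_-\mathcal H\},$$ $$\|X_\pm\|\le\tan\Bigl(\arctan\sqrt{\frac{\rho}{2-\rho}}+\arcsin\nu\Bigr).$$ If, in addition, the projections $\widetilde P_\pm$ are orthogonal, then $X_-=-X_+^*$. -/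

import Mathlib

/-!
Unbounded operators on a complex Hilbert space are Mathlib's `LinearPMap`s; adjoint,
self-adjointness, closedness and cores are Mathlib's. The scalar product of the text, linear in
its first argument, is `(x, y) = inner ℂ y x`.
-/

namespace FormSum

noncomputable section

variable {H : Type*} [NormedAddCommGroup H] [InnerProductSpace ℂ H] [CompleteSpace H]

/-! ### Resolvent set, spectral gap, bounded inverse -/

/-- The resolvent set of a closed operator: all `z` for which `T - z : dom T → H` is bijective. -/
def resSet (T : H →ₗ.[ℂ] H) : Set ℂ :=
  {z | Function.Bijective fun x : T.domain => T x - z • (x : H)}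

/-- The interval `(α, β)` is a spectral gap of `T`: it is contained in the resolvent set. -/
def HasSpectralGap (T : H →ₗ.[ℂ] H) (α β : ℝ) : Prop :=
  ∀ t ∈ Set.Ioo α β, (t : ℂ) ∈ resSet T

/-- `B` is the bounded everywhere defined inverse of `T : dom T → H`. -/
def IsBoundedInverse (T : H →ₗ.[ℂ] H) (B : H →L[ℂ] H) : Prop :=
  (∀ x : T.domain, B (T x) = x) ∧ ∀ y : H, ∃ h : B y ∈ T.domain, T ⟨B y, h⟩ = y

/-- A closed operator with `0` in its resolvent set has a bounded inverse (closed graph theorem). -/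
theorem exists_isBoundedInverse {T : H →ₗ.[ℂ] H} (hT : T.IsClosed)
    (h0 : (0 : ℂ) ∈ resSet T) : ∃ B : H →L[ℂ] H, IsBoundedInverse T B := by
  have hb : Function.Bijective T.toFun := by
    have h : Function.Bijective fun x : T.domain => T x - (0 : ℂ) • (x : H) := h0
    simp only [zero_smul, sub_zero] at h
    exact h
  let e : T.domain ≃ₗ[ℂ] H := LinearEquiv.ofBijective T.toFun hb
  let g : H →ₗ[ℂ] H := T.domain.subtype ∘ₗ e.symm.toLinearMap
  have hTe : ∀ y : H, T (e.symm y) = y := fun y => e.apply_symm_apply y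
  have hg : IsClosed (g.graph : Set (H × H)) := by
    have hpre : (g.graph : Set (H × H)) = Prod.swap ⁻¹' (T.graph : Set (H × H)) := by
      ext ⟨y, x⟩
      simp only [SetLike.mem_coe, LinearMap.mem_graph_iff, Set.mem_preimage, Prod.swap_prod_mk,
        LinearPMap.mem_graph_iff]
      constructor
      · rintro rfl
        exact ⟨e.symm y, rfl, hTe y⟩
      · rintro ⟨x', rfl, rfl⟩
        have : e.symm (T x') = x' := e.symm_apply_apply x'
        simp [g, this]
    rw [hpre]
    exact IsClosed.preimage continuous_swap hT
  refine ⟨ContinuousLinearMap.ofIsClosedGraph hg, ?_, ?_⟩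
  · intro x
    have : e.symm (T x) = x := e.symm_apply_apply x
    simp [g, this]
  · intro y
    exact ⟨(e.symm y).2, hTe y⟩

open scoped Classical in
/-- The bounded inverse `T⁻¹` (uniquely determined when it exists; `0` otherwise). -/
def boundedInverse (T : H →ₗ.[ℂ] H) : H →L[ℂ] H :=
  if h : ∃ B : H →L[ℂ] H, IsBoundedInverse T B then h.choose else 0

/-! ### Functions of a self-adjoint operator with `0` in its resolvent set

For such `T` the inverse `T⁻¹` is a bounded injective self-adjoint operator, and functions of `T`
are functions of `T⁻¹`: `f(T) = g(T⁻¹)` for `g(t) = f(1/t)`. -/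

/-- `|T|^{-1/2} = |T⁻¹|^{1/2}`. -/
def absInvSqrt (T : H →ₗ.[ℂ] H) : H →L[ℂ] H :=
  cfc (fun t : ℝ => √|t|) (boundedInverse T)

/-- `|T|^{1/2}`, the (unbounded) inverse of `|T|^{-1/2}`, with domain the range of
`|T|^{-1/2}`. -/
def absSqrt (T : H →ₗ.[ℂ] H) : H →ₗ.[ℂ] H :=
  ((absInvSqrt T : H →ₗ[ℂ] H).toPMap ⊤).inverse

/-- The positive spectral subspace of `T`, i.e. the range of `1_{(0,∞)}(T) = 1_{(0,∞)}(T⁻¹)`. For a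
bounded self-adjoint operator `A`, `1_{(0,∞)}(A)` is the orthogonal projection onto the closure of
the range of the positive part of `A`. -/
def posSubspace (T : H →ₗ.[ℂ] H) : Submodule ℂ H :=
  (LinearMap.range
    (cfc (fun t : ℝ => max t 0) (boundedInverse T) : H →L[ℂ] H).toLinearMap).topologicalClosure

/-- The negative spectral subspace of `T`, i.e. the range of `1_{(-∞,0)}(T)`. -/
def negSubspace (T : H →ₗ.[ℂ] H) : Submodule ℂ H :=
  (LinearMap.range
    (cfc (fun t : ℝ => max (-t) 0) (boundedInverse T) : H →L[ℂ] H).toLinearMap).topologicalClosure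

instance (T : H →ₗ.[ℂ] H) : CompleteSpace (posSubspace T) :=
  (Submodule.isClosed_topologicalClosure _).completeSpace_coe

instance (T : H →ₗ.[ℂ] H) : CompleteSpace (negSubspace T) :=
  (Submodule.isClosed_topologicalClosure _).completeSpace_coe

/-- The spectral projection `1_{(0,∞)}(T)`. -/
def posProj (T : H →ₗ.[ℂ] H) : H →L[ℂ] H := (posSubspace T).starProjection

/-- The spectral projection `1_{(-∞,0)}(T)`. -/
def negProj (T : H →ₗ.[ℂ] H) : H →L[ℂ] H := (negSubspace T).starProjection

/-- `sign T`. -/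
def signOp (T : H →ₗ.[ℂ] H) : H →L[ℂ] H := posProj T - negProj T

/-! ### Sesquilinear forms -/

/-- A sesquilinear form `v[u, w]` with domain `D`, linear in `u` and conjugate linear in `w`. -/
abbrev SesqForm (D : Submodule ℂ H) : Type _ := D →ₗ[ℂ] D →ₗ⋆[ℂ] ℂ

/-- Symmetry of a sesquilinear form. -/
def IsSymmForm {D : Submodule ℂ H} (v : SesqForm D) : Prop :=
  ∀ u w : D, v u w = starRingEnd ℂ (v w u)

/-- The form represented by `T`: `(|T|^{1/2} u, sign(T) |T|^{1/2} w)` for `u, w` in the domain of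
`|T|^{1/2}`. -/
def reprForm (T : H →ₗ.[ℂ] H) : SesqForm (absSqrt T).domain :=
  LinearMap.mk₂'ₛₗ (RingHom.id ℂ) (starRingEnd ℂ)
    (fun u w => inner ℂ (signOp T (absSqrt T w)) (absSqrt T u))
    (fun u u' w => by rw [LinearPMap.map_add, inner_add_right])
    (fun c u w => by rw [LinearPMap.map_smul, inner_smul_right]; rfl)
    (fun u w w' => by rw [LinearPMap.map_add, map_add, inner_add_left])
    (fun c u w => by rw [LinearPMap.map_smul, map_smul, inner_smul_left]; rfl)

/-- The set of all values `|v[|T|^{-1/2} x, |T|^{-1/2} y]|`, where `x, y ∈ M`, `‖x‖ = ‖y‖ = 1` and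
`|T|^{-1/2} x`, `|T|^{-1/2} y` lie in the domain of `v`. -/
def weightedValues (T : H →ₗ.[ℂ] H) {D : Submodule ℂ H} (v : SesqForm D) (M : Set H) : Set ℝ :=
  {r | ∃ x ∈ M, ∃ y ∈ M, ‖x‖ = 1 ∧ ‖y‖ = 1 ∧
    ∃ (hx : absInvSqrt T x ∈ D) (hy : absInvSqrt T y ∈ D),
      r = ‖v ⟨absInvSqrt T x, hx⟩ ⟨absInvSqrt T y, hy⟩‖}

/-- `w`, a form on the whole domain of `|T|^{1/2}`, is an extension of `v` that is bounded relative
to `|T|^{1/2}`. -/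
def IsFormExtension (T : H →ₗ.[ℂ] H) {D : Submodule ℂ H} (v : SesqForm D)
    (w : SesqForm (absSqrt T).domain) : Prop :=
  BddAbove (weightedValues T w Set.univ) ∧
    ∃ h : D ≤ (absSqrt T).domain,
      ∀ u u' : D, w (Submodule.inclusion h u) (Submodule.inclusion h u') = v u u'

open scoped Classical in
/-- The extension of a relatively bounded form `v`, given on a core of `|T|^{1/2}`, to the domain of
`|T|^{1/2}` by continuity. The extension is unique since `D` is a core. (The value `0` is taken when
there is none, which is never the case for a relatively bounded form on a core.) -/
def formExtension (T : H →ₗ.[ℂ] H) {D : Submodule ℂ H} (v : SesqForm D) :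
    SesqForm (absSqrt T).domain :=
  if h : ∃ w : SesqForm (absSqrt T).domain, IsFormExtension T v w then h.choose else 0

/-- `T` is associated with the form `q`: `T` is closed and densely defined, the domains of `T` and
`T*` are contained in the domain of `q`, `(T u, w) = q[u, w]` for `u ∈ dom T`, `w ∈ dom q`, and
`(u, T* w) = q[u, w]` for `u ∈ dom q`, `w ∈ dom T*`. -/
def IsAssociated (T : H →ₗ.[ℂ] H) {D : Submodule ℂ H} (q : SesqForm D) : Prop :=
  T.IsClosed ∧ Dense (T.domain : Set H) ∧
    (∃ h : T.domain ≤ D, ∀ (u : T.domain) (w : D),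
      inner ℂ (w : H) (T u) = q (Submodule.inclusion h u) w) ∧
    ∃ h : T.adjoint.domain ≤ D, ∀ (u : D) (w : T.adjoint.domain),
      inner ℂ (T.adjoint w) (u : H) = q u (Submodule.inclusion h w)

/-! ### Complementary projections -/

variable (H) in
/-- A pair of complementary bounded projections, not necessarily orthogonal. -/
structure ComplProj where
  /-- The projection with index `+`. -/
  pos : H →L[ℂ] H
  /-- The projection with index `-`. -/
  neg : H →L[ℂ] H
  idem_pos : IsIdempotentElem pos
  idem_neg : IsIdempotentElem neg
  add_eq_one : pos + neg = 1

/-- The range of the projection with index `+`. -/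
def ComplProj.posRange (P : ComplProj H) : Submodule ℂ H := LinearMap.range P.pos.toLinearMap

/-- The range of the projection with index `-`. -/
def ComplProj.negRange (P : ComplProj H) : Submodule ℂ H := LinearMap.range P.neg.toLinearMap

instance (P : ComplProj H) : CompleteSpace P.posRange :=
  (ContinuousLinearMap.IsIdempotentElem.isClosed_range P.idem_pos).completeSpace_coe

instance (P : ComplProj H) : CompleteSpace P.negRange :=
  (ContinuousLinearMap.IsIdempotentElem.isClosed_range P.idem_neg).completeSpace_coe

end

end FormSum

open FormSum

set_option linter.unusedSectionVars false

namespace FormSum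

noncomputable section

variable {H : Type*} [NormedAddCommGroup H] [InnerProductSpace ℂ H] [CompleteSpace H]

/-! ### Inverses of bounded injective operators -/

/-! Put R = |H₀|^{-1/2}, U = P₊ and J = sign H₀ = 2U - 1. The extended perturbation is represented
by a bounded self-adjoint M (`exists_operator_formExtension`), so the form sum is h[Rx, Ry] = (Sx,
y) with S = J + M. In Re (Jx, Sx) the off-diagonal blocks of M cancel and the diagonal ones are
bounded by ρ < 1. Hence Re (Jx, Sx) ≥ (1 - ρ)‖x‖², and S is boundedly invertible
(`isUnit_of_coercive`). The operator sought is the inverse of the bounded injective operator B = R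
S⁻¹ R (`isAssociated_invPMap`, `eq_invPMap_of_isAssociated`).

The angle comes from the sharper inequality (1 - ρ)|(x, Sx)| ≤ Re (Jx, Sx) of `block_estimate`.
Since R commutes with J, the choice x = S⁻¹Rw turns it into Re (w, KBw) ≥ 0 for all w, with K = J -
(1 - ρ). A Lyapunov argument (`nonneg_of_lyapunov`) yields K ≥ 0 on the positive spectral subspace
of B. There (z, Jz) ≥ (1 - ρ)‖z‖², that is ‖z - Uz‖² ≤ (ρ/2)‖z‖², so z makes an angle of at most θ =
arctan √(ρ/(2 - ρ)) with the range of U. The negative subspace is treated by passing to -B and -J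
(`norm_le_of_mem_spectral_subspaces`).

An oblique projection V with ‖U - V‖ ≤ sin φ adds at most φ to this angle (`norm_sub_oblique_le`).
For θ + φ < π/2, V is therefore bounded below on the spectral subspace; a duality argument with V*
makes it onto the range of V (`exists_oblique_apply_eq`). The subspace is then the graph of an
angular operator of norm at most tan (θ + φ). -/

theorem dense_range_of_injective {B : H →L[ℂ] H} (hs : IsSelfAdjoint B)
    (hB : Function.Injective B) : DenseRange B := by
  have h : (LinearMap.range B.toLinearMap)ᗮ = ⊥ := by
    rw [Submodule.eq_bot_iff]
    intro z hz
    apply hB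
    rw [map_zero, ← inner_self_eq_zero (𝕜 := ℂ)]
    rw [Submodule.mem_orthogonal'] at hz
    have := hz (B (B z)) ⟨B z, rfl⟩
    rwa [← ContinuousLinearMap.adjoint_inner_left, hs.adjoint_eq] at this
  have := (Submodule.dense_iff_topologicalClosure_eq_top).2
    ((Submodule.topologicalClosure_eq_top_iff).2 h)
  rwa [LinearMap.coe_range] at this

/-- The inverse, with domain the range of `B`, of a bounded injective operator `B`. -/
def invPMap (B : H →L[ℂ] H) : H →ₗ.[ℂ] H := ((B : H →ₗ[ℂ] H).toPMap ⊤).inverse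

theorem ker_toPMap {B : H →L[ℂ] H} (hB : Function.Injective B) :
    ((B : H →ₗ[ℂ] H).toPMap ⊤).toFun.ker = ⊥ := by
  rw [LinearMap.ker_eq_bot']
  intro x hx
  have h : B x = 0 := hx
  exact Subtype.ext (hB (by simpa using h))

theorem mem_graph_invPMap {B : H →L[ℂ] H} (hB : Function.Injective B) {p : H × H} :
    p ∈ (invPMap B).graph ↔ B p.2 = p.1 := by
  rw [invPMap, LinearPMap.inverse_graph (ker_toPMap hB)]
  constructor
  · rintro ⟨q, hq, rfl⟩
    obtain ⟨z, hz, hz'⟩ := (LinearPMap.mem_graph_iff _).1 hq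
    change B q.1 = q.2
    rw [← hz, ← hz']
    rfl
  · intro h
    exact ⟨(p.2, p.1), (LinearPMap.mem_graph_iff _).2 ⟨⟨p.2, trivial⟩, rfl, h⟩, rfl⟩

theorem mem_domain_invPMap {B : H →L[ℂ] H} {y : H} :
    y ∈ (invPMap B).domain ↔ ∃ x, B x = y := by
  rw [invPMap, LinearPMap.inverse_domain]
  constructor
  · rintro ⟨x, hx⟩
    exact ⟨x, hx⟩
  · rintro ⟨x, hx⟩
    exact ⟨⟨x, trivial⟩, hx⟩

theorem invPMap_apply {B : H →L[ℂ] H} (hB : Function.Injective B) (x : H)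
    (h : B x ∈ (invPMap B).domain) : invPMap B ⟨B x, h⟩ = x := by
  have := (mem_graph_invPMap hB).1 ((invPMap B).mem_graph ⟨B x, h⟩)
  exact hB this

theorem apply_invPMap {B : H →L[ℂ] H} (hB : Function.Injective B) (y : (invPMap B).domain) :
    B (invPMap B y) = y :=
  (mem_graph_invPMap hB).1 ((invPMap B).mem_graph y)

theorem isClosed_invPMap {B : H →L[ℂ] H} (hB : Function.Injective B) :
    (invPMap B).IsClosed := by
  have : ((invPMap B).graph : Set (H × H)) = {p | B p.2 = p.1} := by
    ext p
    exact mem_graph_invPMap hB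
  rw [LinearPMap.IsClosed, this]
  exact isClosed_eq (by fun_prop) (by fun_prop)

theorem dense_domain_invPMap {B : H →L[ℂ] H} (hs : IsSelfAdjoint B)
    (hB : Function.Injective B) : Dense ((invPMap B).domain : Set H) := by
  have : ((invPMap B).domain : Set H) = Set.range B := by
    ext y
    exact mem_domain_invPMap
  rw [this]
  exact dense_range_of_injective hs hB

theorem isBoundedInverse_invPMap {B : H →L[ℂ] H} (hB : Function.Injective B) :
    IsBoundedInverse (invPMap B) B :=
  ⟨apply_invPMap hB, fun y => ⟨mem_domain_invPMap.2 ⟨y, rfl⟩, invPMap_apply hB y _⟩⟩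

theorem IsBoundedInverse.unique {T : H →ₗ.[ℂ] H} {B B' : H →L[ℂ] H} (h : IsBoundedInverse T B)
    (h' : IsBoundedInverse T B') : B = B' := by
  ext y
  obtain ⟨hy, e⟩ := h.2 y
  rw [← e, h'.1 ⟨B y, hy⟩, e]

theorem boundedInverse_spec {T : H →ₗ.[ℂ] H} (h : ∃ B, IsBoundedInverse T B) :
    IsBoundedInverse T (boundedInverse T) := by
  rw [boundedInverse, dif_pos h]
  exact h.choose_spec

theorem boundedInverse_invPMap {B : H →L[ℂ] H} (hB : Function.Injective B) :
    boundedInverse (invPMap B) = B :=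
  (boundedInverse_spec ⟨B, isBoundedInverse_invPMap hB⟩).unique (isBoundedInverse_invPMap hB)

theorem zero_mem_resSet_invPMap {B : H →L[ℂ] H} (hB : Function.Injective B) :
    (0 : ℂ) ∈ resSet (invPMap B) := by
  refine ⟨fun x y hxy => ?_, fun y => ⟨⟨B y, mem_domain_invPMap.2 ⟨y, rfl⟩⟩, ?_⟩⟩
  · simp only [zero_smul, sub_zero] at hxy
    apply Subtype.ext
    rw [← apply_invPMap hB x, ← apply_invPMap hB y, hxy]
  · simp only [zero_smul, sub_zero]
    exact invPMap_apply hB y _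

theorem isSelfAdjoint_invPMap {B : H →L[ℂ] H} (hs : IsSelfAdjoint B)
    (hB : Function.Injective B) : IsSelfAdjoint (invPMap B) := by
  have hd := dense_domain_invPMap hs hB
  rw [LinearPMap.isSelfAdjoint_def]
  have hsym : ∀ x y, inner ℂ (B x) y = inner ℂ x (B y) := fun x y => by
    rw [← ContinuousLinearMap.adjoint_inner_right, hs.adjoint_eq]
  apply le_antisymm
  · apply LinearPMap.le_of_le_graph
    rintro ⟨y, z⟩ hyz
    rw [mem_graph_invPMap hB]
    obtain ⟨y', rfl, rfl⟩ := (LinearPMap.mem_graph_iff _).1 hyz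
    refine ext_inner_right ℂ fun x => ?_
    have := LinearPMap.adjoint_isFormalAdjoint hd y' ⟨B x, mem_domain_invPMap.2 ⟨x, rfl⟩⟩
    rw [invPMap_apply hB] at this
    rw [← this]
    exact hsym _ _
  · refine LinearPMap.IsFormalAdjoint.le_adjoint hd fun x y => ?_
    conv_lhs => rw [← apply_invPMap hB y]
    conv_rhs => rw [← apply_invPMap hB x]
    exact (hsym _ _).symm

theorem graph_domRestrict_invPMap {B : H →L[ℂ] H} (hB : Function.Injective B) (D : Submodule ℂ H)
    (p : H × H) :
    p ∈ ((invPMap B).domRestrict D).graph ↔ B p.2 = p.1 ∧ p.1 ∈ D := by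
  constructor
  · intro h
    refine ⟨(mem_graph_invPMap hB).1
      (LinearPMap.le_graph_of_le (LinearPMap.domRestrict_le) h), ?_⟩
    obtain ⟨z, hz, -⟩ := (LinearPMap.mem_graph_iff _).1 h
    rw [← hz]
    exact (Submodule.mem_inf.1 z.2).1
  · rintro ⟨h, hD⟩
    have hm : p.1 ∈ (invPMap B).domain := mem_domain_invPMap.2 ⟨_, h⟩
    have hm' : p.1 ∈ ((invPMap B).domRestrict D).domain := ⟨hD, hm⟩
    have e : (invPMap B).domRestrict D ⟨p.1, hm'⟩ = invPMap B ⟨p.1, hm⟩ :=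
      LinearPMap.domRestrict_apply rfl
    refine (LinearPMap.mem_graph_iff _).2 ⟨⟨p.1, hm'⟩, rfl, e.trans (hB ?_)⟩
    rw [apply_invPMap hB, h]

/-- A subspace of the range of `B` is a core of `B⁻¹` iff its preimage is dense. -/
theorem hasCore_invPMap_iff {B : H →L[ℂ] H} (hB : Function.Injective B) (D : Submodule ℂ H) :
    (invPMap B).HasCore D ↔
      D ≤ (invPMap B).domain ∧ Dense (D.comap B.toLinearMap : Set H) := by
  have hcl : ((invPMap B).domRestrict D).IsClosable :=
    (isClosed_invPMap hB).isClosable.leIsClosable LinearPMap.domRestrict_le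
  constructor
  · rintro ⟨h, hc⟩
    refine ⟨h, fun x => ?_⟩
    have hx : (B x, x) ∈ ((invPMap B).domRestrict D).graph.topologicalClosure := by
      rw [hcl.graph_closure_eq_closure_graph, hc, mem_graph_invPMap hB]
    rw [← SetLike.mem_coe, Submodule.topologicalClosure_coe] at hx
    have := image_closure_subset_closure_image continuous_snd ⟨_, hx, rfl⟩
    refine closure_mono ?_ this
    rintro _ ⟨p, hp, rfl⟩
    obtain ⟨h1, h2⟩ := (graph_domRestrict_invPMap hB D p).1 hp
    change B p.2 ∈ D
    rwa [h1]
  · rintro ⟨h, hd⟩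
    refine ⟨h, LinearPMap.eq_of_eq_graph ?_⟩
    rw [← hcl.graph_closure_eq_closure_graph]
    apply le_antisymm
    · exact Submodule.topologicalClosure_minimal _
        (LinearPMap.le_graph_of_le LinearPMap.domRestrict_le) (isClosed_invPMap hB)
    · rintro ⟨y, x⟩ hp
      have hp' : B x = y := (mem_graph_invPMap hB).1 hp
      subst hp'
      rw [← SetLike.mem_coe, Submodule.topologicalClosure_coe]
      have hc : Continuous fun x => (B x, x) := by fun_prop
      have := image_closure_subset_closure_image hc ⟨x, hd x, rfl⟩
      refine closure_mono ?_ this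
      rintro _ ⟨z, hz, rfl⟩
      exact (graph_domRestrict_invPMap hB D _).2 ⟨rfl, hz⟩

/-! ### The bounded inverse of a self-adjoint operator -/

section

variable {T : H →ₗ.[ℂ] H}

theorem isBoundedInverse_boundedInverse (hT : IsSelfAdjoint T) (h0 : (0 : ℂ) ∈ resSet T) :
    IsBoundedInverse T (boundedInverse T) :=
  boundedInverse_spec (exists_isBoundedInverse hT.isClosed h0)

theorem isSelfAdjoint_boundedInverse (hT : IsSelfAdjoint T) (h0 : (0 : ℂ) ∈ resSet T) :
    IsSelfAdjoint (boundedInverse T) := by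
  have h := isBoundedInverse_boundedInverse hT h0
  rw [ContinuousLinearMap.isSelfAdjoint_iff_isSymmetric]
  intro x y
  obtain ⟨hx, ex⟩ := h.2 x
  obtain ⟨hy, ey⟩ := h.2 y
  have hf := LinearPMap.adjoint_isFormalAdjoint hT.dense_domain
  rw [(LinearPMap.isSelfAdjoint_def).1 hT] at hf
  have := hf ⟨_, hx⟩ ⟨_, hy⟩
  rw [ex, ey] at this
  exact this.symm

theorem injective_boundedInverse (hT : IsSelfAdjoint T) (h0 : (0 : ℂ) ∈ resSet T) :
    Function.Injective (boundedInverse T) := by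
  have h := isBoundedInverse_boundedInverse hT h0
  intro x y hxy
  obtain ⟨hx, ex⟩ := h.2 x
  obtain ⟨hy, ey⟩ := h.2 y
  rw [← ex, ← ey]
  congr 1
  exact Subtype.ext hxy

theorem isSelfAdjoint_absInvSqrt (T : H →ₗ.[ℂ] H) : IsSelfAdjoint (absInvSqrt T) :=
  cfc_predicate _ _

/-- By t = (sign t · √|t|) · √|t|, the injective inverse of `T` has `absInvSqrt T` as its right
factor. -/
theorem injective_absInvSqrt (hT : IsSelfAdjoint T) (h0 : (0 : ℂ) ∈ resSet T) :
    Function.Injective (absInvSqrt T) := by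
  have hs := isSelfAdjoint_boundedInverse hT h0
  have hf : boundedInverse T =
      cfc (fun t : ℝ => SignType.sign t * √|t|) (boundedInverse T) * absInvSqrt T := by
    -- The sign jumps at 0, but √|t| vanishes there, so the product is continuous and the continuous
    -- functional calculus applies.
    have hc : Continuous fun t : ℝ => (SignType.sign t : ℝ) * √|t| := by
      refine continuous_iff_continuousAt.2 fun t => ?_
      rcases eq_or_ne t 0 with rfl | ht
      · rw [ContinuousAt, sign_zero]
        simp only [SignType.coe_zero, zero_mul]
        refine squeeze_zero_norm (a := fun t : ℝ => √|t|) (fun t => ?_) ?_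
        · rw [norm_mul, Real.norm_of_nonneg (Real.sqrt_nonneg _)]
          refine mul_le_of_le_one_left (Real.sqrt_nonneg _) ?_
          rcases lt_trichotomy t 0 with h | h | h <;> simp [h]
        · have : Continuous fun t : ℝ => √|t| := by fun_prop
          simpa using this.tendsto 0
      · rcases lt_or_gt_of_ne ht with h | h
        · refine ContinuousAt.congr (f := fun t : ℝ => -√|t|) (by fun_prop) ?_
          filter_upwards [gt_mem_nhds h] with s hs
          simp [sign_neg hs]
        · refine ContinuousAt.congr (f := fun t : ℝ => √|t|) (by fun_prop) ?_
          filter_upwards [lt_mem_nhds h] with s hs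
          simp [sign_pos hs]
    rw [absInvSqrt, ← cfc_mul _ _ _ hc.continuousOn (by fun_prop)]
    conv_lhs => rw [← cfc_id' ℝ (boundedInverse T)]
    refine cfc_congr fun t _ => ?_
    simp only [mul_assoc, Real.mul_self_sqrt (abs_nonneg t)]
    exact (sign_mul_abs t).symm
  have hi := injective_boundedInverse hT h0
  intro x y hxy
  apply hi
  rw [hf, mul_apply_eq_comp, mul_apply_eq_comp, hxy]

end

/-! ### A Lyapunov inequality -/

theorem re_inner_apply_swap {N : H →L[ℂ] H} (hN : IsSelfAdjoint N) (x y : H) :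
    RCLike.re (inner ℂ x (N y)) = RCLike.re (inner ℂ y (N x)) := by
  rw [← ContinuousLinearMap.adjoint_inner_left, hN.adjoint_eq, ← inner_conj_symm, RCLike.conj_re]

/-- Cauchy–Schwarz and ‖Jx‖ ≤ ‖x‖ give c‖x‖ ≤ ‖Gx‖, so `G` is injective with closed range;
self-adjointness makes the range dense. -/
theorem isUnit_of_coercive (G J : H →L[ℂ] H) (hJ : ∀ x, ‖J x‖ ≤ ‖x‖) {c : ℝ} (hc : 0 < c)
    (h : ∀ x, c * ‖x‖ ^ 2 ≤ RCLike.re (inner ℂ (J x) (G x)))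
    (hs : IsSelfAdjoint G) : IsUnit G := by
  have hb : ∀ x, c * ‖x‖ ≤ ‖G x‖ := by
    intro x
    rcases eq_or_ne x 0 with rfl | hx
    · simp
    have hx' : 0 < ‖x‖ := norm_pos_iff.2 hx
    have h1 := (RCLike.re_le_norm (inner ℂ (J x) (G x))).trans (norm_inner_le_norm (𝕜 := ℂ) _ _)
    have h2 := mul_le_mul_of_nonneg_right (hJ x) (norm_nonneg (G x))
    have h3 := h x
    refine le_of_mul_le_mul_left ?_ hx'
    nlinarith
  have hinj : Function.Injective G := by
    refine (injective_iff_map_eq_zero G).2 fun x hx => ?_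
    have := hb x
    rw [hx, norm_zero] at this
    exact norm_le_zero_iff.1 (by nlinarith [norm_nonneg x])
  have hanti : AntilipschitzWith c⁻¹.toNNReal G := by
    refine ContinuousLinearMap.antilipschitz_of_bound G fun x => ?_
    rw [Real.coe_toNNReal _ (by positivity), inv_mul_eq_div, le_div_iff₀ hc, mul_comm]
    exact hb x
  have hcl : IsClosed (Set.range G) := hanti.isClosed_range G.uniformContinuous
  have hsurj : Function.Surjective G := by
    rw [← Set.range_eq_univ, ← hcl.closure_eq]
    exact (dense_range_of_injective hs hinj).closure_eq
  rw [ContinuousLinearMap.isUnit_iff_bijective]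
  exact ⟨hinj, hsurj⟩

/-- If `Re (Y x, x) ≤ 0` for all `x`, then no positive number lies in the spectrum of `Y`. -/
theorem notMem_spectrum_of_re_nonpos {Y : H →L[ℂ] H}
    (h : ∀ x, RCLike.re (inner ℂ x (Y x)) ≤ 0) {r : ℝ} (hr : 0 < r) : (r : ℂ) ∉ spectrum ℂ Y := by
  rw [spectrum.notMem_iff]
  refine ContinuousLinearMap.isUnit_of_forall_le_norm_inner_map _ (c := r.toNNReal)
    (Real.toNNReal_pos.2 hr) fun x => ?_
  have e : RCLike.re (inner ℂ x ((algebraMap ℂ (H →L[ℂ] H) (r : ℂ) - Y) x)) =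
      r * ‖x‖ ^ 2 - RCLike.re (inner ℂ x (Y x)) := by
    simp only [sub_apply, Algebra.algebraMap_eq_smul_one,
      smul_apply, one_apply_eq_self, inner_sub_right,
      inner_smul_right, map_sub]
    congr 1
    change ((r : ℂ) * inner ℂ x x).re = _
    rw [Complex.re_ofReal_mul]
    congr 1
    exact inner_self_eq_norm_sq (𝕜 := ℂ) x
  rw [norm_inner_symm]
  refine le_trans ?_ (RCLike.re_le_norm _)
  rw [e, Real.coe_toNNReal _ hr.le, mul_comm]
  linarith [h x]

theorem eq_zero_of_self_mul_self {Y : H →L[ℂ] H} (h : star Y * Y = 0) : Y = 0 :=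
  CStarRing.star_mul_self_eq_zero_iff Y |>.1 h

theorem eq_zero_of_nonneg_of_spectrum {Y : H →L[ℂ] H} (hY : 0 ≤ Y)
    (h : ∀ r : ℝ, 0 < r → (r : ℂ) ∉ spectrum ℂ Y) : Y = 0 := by
  by_contra hne
  have : Nontrivial (H →L[ℂ] H) := ⟨Y, 0, hne⟩
  have h1 := CStarAlgebra.norm_mem_spectrum_of_nonneg hY
  refine h ‖Y‖ (norm_pos_iff.2 hne) ?_
  simpa using spectrum.algebraMap_mem ℂ h1

/-- If `N` is of the form `b K b` with `b` self-adjoint and `N b² + b² N ≥ 0`, then `N ≥ 0`. -/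
theorem nonneg_of_lyapunov {b K : H →L[ℂ] H} (hb : IsSelfAdjoint b) (hK : IsSelfAdjoint K)
    (h : ∀ x, 0 ≤ RCLike.re (inner ℂ x ((b * K * b) ((b * b) x)))) (x : H) :
    0 ≤ RCLike.re (inner ℂ (b x) (K (b x))) := by
  set N := b * K * b with hNdef
  have hN : IsSelfAdjoint N := by
    rw [isSelfAdjoint_iff, hNdef, star_mul, star_mul, hb.star_eq, hK.star_eq, mul_assoc]
  -- L is the negative part of N; the aim is L = 0.
  obtain ⟨L, hL0, hNL, hNp⟩ : ∃ L : H →L[ℂ] H, 0 ≤ L ∧ L * N = -(L * L) ∧ 0 ≤ N + L := by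
    refine ⟨N⁻, CFC.negPart_nonneg N, ?_, ?_⟩
    · have e : N = N⁺ - N⁻ := (CFC.posPart_sub_negPart N hN).symm
      calc N⁻ * N = N⁻ * (N⁺ - N⁻) := congrArg (N⁻ * ·) e
        _ = _ := by rw [mul_sub, CFC.negPart_mul_posPart, zero_sub]
    · have e : N = N⁺ - N⁻ := (CFC.posPart_sub_negPart N hN).symm
      rw [← sub_eq_iff_eq_add.1 e.symm]
      exact CFC.posPart_nonneg N
  have hLs : IsSelfAdjoint L := IsSelfAdjoint.of_nonneg hL0
  -- Testing the hypothesis on Lx and using LN = -L² gives Re (x, L²b²Lx) ≤ 0. Interchanging the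
  -- factors L²b and bL preserves the nonzero spectrum, so the nonnegative operator bL³b has no
  -- positive spectrum.
  have hsp : ∀ r : ℝ, 0 < r → (r : ℂ) ∉ spectrum ℂ (b * L * L * L * b) := by
    intro r hr hmem
    have hr0 : (r : ℂ) ≠ 0 := by exact_mod_cast hr.ne'
    have h1 : (r : ℂ) ∈ spectrum ℂ ((b * L) * (L * L * b)) \ {0} := by
      refine ⟨?_, hr0⟩
      simpa only [mul_assoc] using hmem
    rw [spectrum.nonzero_mul_comm] at h1
    refine notMem_spectrum_of_re_nonpos (Y := (L * L * b) * (b * L)) (fun x => ?_) hr h1.1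
    have h2 := h (L x)
    have e : inner ℂ (L x) (N ((b * b) (L x))) = -inner ℂ x (((L * L * b) * (b * L)) x) := by
      rw [← ContinuousLinearMap.adjoint_inner_right, hLs.adjoint_eq, ← inner_neg_right]
      congr 1
      have := congrArg (fun Z : H →L[ℂ] H => Z ((b * b) (L x))) hNL
      simpa [mul_assoc] using this
    rw [e, map_neg] at h2
    linarith
  have hsq : CFC.sqrt L * CFC.sqrt L = L := CFC.sqrt_mul_sqrt_self L hL0
  have hsqs : star (CFC.sqrt L) = CFC.sqrt L := (IsSelfAdjoint.of_nonneg (CFC.sqrt_nonneg L)).star_eq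
  have e0 : b * L * L * L * b = star (CFC.sqrt L * (L * b)) * (CFC.sqrt L * (L * b)) := by
    rw [star_mul, star_mul, hb.star_eq, hLs.star_eq, hsqs]
    calc _ = b * L * (CFC.sqrt L * CFC.sqrt L) * (L * b) := by rw [hsq]; simp only [mul_assoc]
      _ = _ := by simp only [mul_assoc]
  -- Hence bL³b = 0, and its factors are stripped one at a time: √L·L·b = 0, then Lb = 0, then L² =
  -- -LN = -(Lb)Kb = 0.
  have h3 : CFC.sqrt L * (L * b) = 0 := by
    apply eq_zero_of_self_mul_self
    rw [← e0]
    refine eq_zero_of_nonneg_of_spectrum ?_ hsp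
    rw [e0]
    exact star_mul_self_nonneg _
  have h4 : L * b = 0 := by
    apply eq_zero_of_self_mul_self
    rw [star_mul, hb.star_eq, hLs.star_eq]
    calc b * L * (L * b) = b * (CFC.sqrt L * CFC.sqrt L) * (L * b) := by rw [hsq]
      _ = b * CFC.sqrt L * (CFC.sqrt L * (L * b)) := by simp only [mul_assoc]
      _ = 0 := by rw [h3, mul_zero]
  have h5 : L * L = 0 := by
    rw [← neg_eq_zero, ← hNL, hNdef, ← mul_assoc, ← mul_assoc, h4, zero_mul, zero_mul]
  have h6 : L = 0 := by
    apply eq_zero_of_self_mul_self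
    rw [hLs.star_eq, h5]
  rw [h6, add_zero] at hNp
  have h7 := ((ContinuousLinearMap.nonneg_iff_isPositive N).1 hNp).re_inner_nonneg_right x
  have e : inner ℂ x (N x) = inner ℂ (b x) (K (b x)) := by
    rw [hNdef, ← ContinuousLinearMap.adjoint_inner_right, hb.adjoint_eq]
    rfl
  rwa [e] at h7

/-- If `Re (K B w, w) ≥ 0` for all `w`, then `K ≥ 0` on the positive spectral subspace of `B`. -/
theorem re_inner_nonneg_of_mem_closure_range_posPart {B K : H →L[ℂ] H} (hB : IsSelfAdjoint B)
    (hK : IsSelfAdjoint K) (h : ∀ w, 0 ≤ RCLike.re (inner ℂ w (K (B w)))) {z : H}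
    (hz : z ∈ (LinearMap.range
      (cfc (fun t : ℝ => max t 0) B : H →L[ℂ] H).toLinearMap).topologicalClosure) :
    0 ≤ RCLike.re (inner ℂ z (K z)) := by
  -- With b the square root of the positive part of B one has Bb = b³, so the hypothesis at w = bx
  -- is the Lyapunov inequality for bKb. Its conclusion at `b y` concerns b²y, a general vector in
  -- the range of the positive part.
  set b : H →L[ℂ] H := cfc (fun t : ℝ => √(max t 0)) B with hbdef
  have hb : IsSelfAdjoint b := cfc_predicate _ _
  have hbb : b * b = cfc (fun t : ℝ => max t 0) B := by
    rw [hbdef, ← cfc_mul _ _ _ (by fun_prop) (by fun_prop)]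
    refine cfc_congr fun t _ => Real.mul_self_sqrt (le_max_right _ _)
  have hBb : B * b = b * (b * b) := by
    rw [hbb, hbdef, ← cfc_mul _ _ _ (by fun_prop) (by fun_prop)]
    conv_lhs => rw [← cfc_id' ℝ B, cfc_id' ℝ B]
    nth_rewrite 1 [← cfc_id' ℝ B]
    rw [← cfc_mul _ _ _ (by fun_prop) (by fun_prop)]
    refine cfc_congr fun t _ => ?_
    rcases le_total t 0 with ht | ht
    · simp [max_eq_right ht]
    · simp [max_eq_left ht, mul_comm]
  have hN : ∀ x, 0 ≤ RCLike.re (inner ℂ x ((b * K * b) ((b * b) x))) := by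
    intro x
    have h1 := h (b x)
    have e : B (b x) = b ((b * b) x) := congrArg (fun Z : H →L[ℂ] H => Z x) hBb
    rw [e, ← ContinuousLinearMap.adjoint_inner_right, hb.adjoint_eq] at h1
    exact h1
  have hcl : IsClosed {z : H | 0 ≤ RCLike.re (inner ℂ z (K z))} :=
    isClosed_le continuous_const (by fun_prop)
  rw [← SetLike.mem_coe, Submodule.topologicalClosure_coe] at hz
  refine closure_minimal ?_ hcl hz
  rintro _ ⟨y, rfl⟩
  change 0 ≤ RCLike.re (inner ℂ ((cfc (fun t : ℝ => max t 0) B : H →L[ℂ] H) y)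
    (K ((cfc (fun t : ℝ => max t 0) B : H →L[ℂ] H) y)))
  rw [← hbb]
  exact nonneg_of_lyapunov hb hK hN (b y)

/-! ### Oblique projections close to an orthogonal projection -/

/-- Turns a bound on one leg of a right triangle with hypotenuse `X` into an angle, so that later
estimates can use the addition formulas. For X > 0 the angle is arcsin (a/X). -/
theorem exists_angle {a A X φ : ℝ} (ha : 0 ≤ a) (hA : 0 ≤ A) (hX : 0 ≤ X)
    (h : a ^ 2 + A ^ 2 = X ^ 2) (hφ : 0 ≤ φ) (hφ' : φ ≤ Real.pi / 2) (hle : a ≤ Real.sin φ * X) :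
    ∃ α, 0 ≤ α ∧ α ≤ φ ∧ a = X * Real.sin α ∧ A = X * Real.cos α := by
  rcases hX.eq_or_lt with rfl | hX
  · exact ⟨0, le_rfl, hφ, by nlinarith, by nlinarith⟩
  have h1 : a / X ≤ Real.sin φ := (div_le_iff₀ hX).2 hle
  have h0 : 0 ≤ a / X := by positivity
  have hs : Real.sin (Real.arcsin (a / X)) = a / X :=
    Real.sin_arcsin (by linarith) (h1.trans (Real.sin_le_one φ))
  refine ⟨Real.arcsin (a / X), Real.arcsin_nonneg.2 h0, ?_, ?_, ?_⟩
  · rw [← Real.arcsin_sin (by linarith [Real.pi_pos]) hφ']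
    exact Real.monotone_arcsin h1
  · rw [hs]
    field_simp
  · rw [Real.cos_arcsin]
    have : 1 - (a / X) ^ 2 = (A / X) ^ 2 := by
      field_simp
      linarith
    rw [this, Real.sqrt_sq (by positivity)]
    field_simp

theorem norm_sq_add_norm_sub_sq {U : H →L[ℂ] H} (hU : IsSelfAdjoint U) (hU2 : IsIdempotentElem U)
    (w : H) : ‖w - U w‖ ^ 2 + ‖U w‖ ^ 2 = ‖w‖ ^ 2 := by
  have h : inner ℂ (w - U w) (U w) = 0 := by
    rw [← ContinuousLinearMap.adjoint_inner_left, hU.adjoint_eq, map_sub]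
    have : U (U w) = U w := congrArg (fun Z : H →L[ℂ] H => Z w) hU2
    rw [this, sub_self, inner_zero_left]
  have := norm_add_sq_eq_norm_sq_add_norm_sq_of_inner_eq_zero (w - U w) (U w) h
  rw [sub_add_cancel] at this
  nlinarith

section

variable {U V : H →L[ℂ] H} {θ φ : ℝ}

/-- Split z = x + y with x = Vz in the range and y = z - Vz in the kernel of V. On these two
subspaces U - V acts as U - 1 and as U, so x makes an angle α ≤ φ with the range of U, and y an
angle β ≤ φ with its kernel. -/
theorem norm_sub_oblique_le (hU : IsSelfAdjoint U) (hU2 : IsIdempotentElem U)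
    (hV : IsIdempotentElem V) (hθ : 0 ≤ θ) (hφ : 0 ≤ φ) (hθφ : θ + φ < Real.pi / 2)
    (hUV : ‖U - V‖ ≤ Real.sin φ) {z : H} (hz : ‖z - U z‖ ≤ Real.sin θ * ‖z‖) :
    ‖z - V z‖ ≤ Real.tan (θ + φ) * ‖V z‖ := by
  have hpi := Real.pi_pos
  have hVV : V (V z) = V z := congrArg (fun Z : H →L[ℂ] H => Z z) hV
  have hx : ‖V z - U (V z)‖ ≤ Real.sin φ * ‖V z‖ := by
    have : V z - U (V z) = -((U - V) (V z)) := by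
      rw [sub_apply, hVV, neg_sub]
    rw [this, norm_neg]
    exact (ContinuousLinearMap.le_opNorm _ _).trans (by gcongr)
  have hy : ‖U (z - V z)‖ ≤ Real.sin φ * ‖z - V z‖ := by
    have : U (z - V z) = (U - V) (z - V z) := by
      rw [sub_apply, map_sub V, hVV, sub_self, sub_zero]
    rw [this]
    exact (ContinuousLinearMap.le_opNorm _ _).trans (by gcongr)
  obtain ⟨α, hα0, hα, e1, e2⟩ := exists_angle (norm_nonneg _) (norm_nonneg _) (norm_nonneg _)
    (norm_sq_add_norm_sub_sq hU hU2 (V z)) hφ (by linarith) hx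
  obtain ⟨β, hβ0, hβ, e3, e4⟩ := exists_angle (norm_nonneg _) (norm_nonneg _) (norm_nonneg _)
    ((add_comm _ _).trans (norm_sq_add_norm_sub_sq hU hU2 (z - V z))) hφ (by linarith) hy
  obtain ⟨γ, hγ0, hγ, e5, e6⟩ := exists_angle (norm_nonneg _) (norm_nonneg _) (norm_nonneg _)
    (norm_sq_add_norm_sub_sq hU hU2 z) hθ (by linarith) hz
  have hcθ : 0 ≤ Real.cos θ := Real.cos_nonneg_of_mem_Icc ⟨by linarith, by linarith⟩
  have hsθ : 0 ≤ Real.sin θ := Real.sin_nonneg_of_nonneg_of_le_pi hθ (by linarith)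
  -- The hypothesis on z in tangent form, from sin (θ - γ) ≥ 0 for the angle γ of z.
  have h1 : Real.cos θ * ‖z - U z‖ ≤ Real.sin θ * ‖U z‖ := by
    have hs : 0 ≤ Real.sin (θ - γ) := Real.sin_nonneg_of_nonneg_of_le_pi (by linarith) (by linarith)
    rw [Real.sin_sub] at hs
    rw [e5, e6]
    nlinarith [norm_nonneg z]
  have h2 : ‖(z - V z) - U (z - V z)‖ ≤ ‖z - U z‖ + ‖V z - U (V z)‖ := by
    have : (z - V z) - U (z - V z) = (z - U z) - (V z - U (V z)) := by
      rw [map_sub]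
      abel
    rw [this]
    exact norm_sub_le _ _
  have h3 : ‖U z‖ ≤ ‖U (V z)‖ + ‖U (z - V z)‖ := by
    have : U z = U (V z) + U (z - V z) := by rw [← map_add, add_sub_cancel]
    rw [this]
    exact norm_add_le _ _
  -- The triangle inequalities `h2` and `h3`, weighted by cos θ and sin θ and joined through `h1`,
  -- assemble into the addition formulas.
  have h4 : ‖z - V z‖ * Real.cos (θ + β) ≤ ‖V z‖ * Real.sin (θ + α) := by
    rw [Real.cos_add, Real.sin_add]
    have := mul_le_mul_of_nonneg_left h2 hcθ
    have := mul_le_mul_of_nonneg_left h3 hsθ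
    rw [e1, e4] at *
    rw [e2, e3] at *
    linarith
  have h5 : Real.cos (θ + φ) ≤ Real.cos (θ + β) :=
    Real.cos_le_cos_of_nonneg_of_le_pi (by linarith) (by linarith) (by linarith)
  have h6 : Real.sin (θ + α) ≤ Real.sin (θ + φ) :=
    Real.sin_le_sin_of_le_of_le_pi_div_two (by linarith) (by linarith) (by linarith)
  have hc : 0 < Real.cos (θ + φ) := Real.cos_pos_of_mem_Ioo ⟨by linarith, by linarith⟩
  rw [Real.tan_eq_sin_div_cos, div_mul_eq_mul_div, le_div_iff₀ hc]
  calc ‖z - V z‖ * Real.cos (θ + φ) ≤ ‖z - V z‖ * Real.cos (θ + β) := by gcongr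
    _ ≤ ‖V z‖ * Real.sin (θ + α) := h4
    _ ≤ ‖V z‖ * Real.sin (θ + φ) := by gcongr
    _ = _ := mul_comm _ _

/-- The lower bound on `Z` makes V(Z) closed. A vector w orthogonal to the preimage of V(Z) under V
is orthogonal to `Z` and to the kernel of V, hence V*w = w; the angle estimate for 1 - U and 1 - V*
then bounds ‖w‖ by a multiple of ‖(1 - V*)w‖ = 0. -/
theorem exists_oblique_apply_eq (hU : IsSelfAdjoint U) (hU2 : IsIdempotentElem U)
    (hV : IsIdempotentElem V) (hθ : 0 ≤ θ) (hφ : 0 ≤ φ) (hθφ : θ + φ < Real.pi / 2)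
    (hUV : ‖U - V‖ ≤ Real.sin φ) {Z : Submodule ℂ H} (hZc : IsClosed (Z : Set H))
    (hZ : ∀ z ∈ Z, ‖z - U z‖ ≤ Real.sin θ * ‖z‖) (hZ' : ∀ z ∈ Zᗮ, ‖U z‖ ≤ Real.sin θ * ‖z‖)
    (x : H) : ∃ z ∈ Z, V z = V x := by
  have : CompleteSpace Z := hZc.completeSpace_coe
  have ht : 0 ≤ Real.tan (θ + φ) :=
    Real.tan_nonneg_of_nonneg_of_le_pi_div_two (by linarith) hθφ.le
  let F : Z →L[ℂ] H := V.comp Z.subtypeL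
  have hanti : AntilipschitzWith (1 + Real.tan (θ + φ)).toNNReal F := by
    refine ContinuousLinearMap.antilipschitz_of_bound F fun z => ?_
    rw [Real.coe_toNNReal _ (by positivity)]
    have h1 := norm_sub_oblique_le hU hU2 hV hθ hφ hθφ hUV (hZ z z.2)
    have h2 : ‖(z : H)‖ ≤ ‖V z‖ + ‖(z : H) - V z‖ := by
      conv_lhs => rw [← add_sub_cancel (V z) (z : H)]
      exact norm_add_le _ _
    change ‖(z : H)‖ ≤ _ * ‖V z‖
    linarith
  have hcl : IsClosed (LinearMap.range F.toLinearMap : Set H) :=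
    hanti.isClosed_range F.uniformContinuous
  set N : Submodule ℂ H := (LinearMap.range F.toLinearMap).comap V.toLinearMap with hN
  have hNc : IsClosed (N : Set H) := hcl.preimage V.continuous
  have hVV : ∀ w, V (V w) = V w := fun w => congrArg (fun Z : H →L[ℂ] H => Z w) hV
  have hNo : Nᗮ = ⊥ := by
    rw [Submodule.eq_bot_iff]
    intro w hw
    rw [Submodule.mem_orthogonal] at hw
    have h1 : w ∈ Zᗮ := by
      rw [Submodule.mem_orthogonal]
      exact fun z hz => hw z ⟨⟨z, hz⟩, rfl⟩
    have h2 : (star V) w = w := by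
      refine ext_inner_left ℂ fun y => ?_
      have h := hw (y - V y) ⟨0, by
        change F 0 = V (y - V y)
        rw [map_zero, map_sub, hVV, sub_self]⟩
      rw [inner_sub_left, sub_eq_zero] at h
      rw [ContinuousLinearMap.star_eq_adjoint, ContinuousLinearMap.adjoint_inner_right, h]
    have h3 := norm_sub_oblique_le (U := 1 - U) (V := 1 - star V) (z := w)
      ((IsSelfAdjoint.one _).sub hU) hU2.one_sub
      (IsIdempotentElem.one_sub (by
        rw [IsIdempotentElem, ← star_mul, hV])) hθ hφ hθφ
      (by
        have e : (1 - U) - (1 - star V) = -star (U - V) := by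
          rw [star_sub, hU.star_eq]
          abel
        rw [e, norm_neg, norm_star]
        exact hUV)
      (by simpa using hZ' w h1)
    simpa [h2] using h3
  have hNt : N = ⊤ := by
    rw [← hNc.submodule_topologicalClosure_eq]
    exact (Submodule.topologicalClosure_eq_top_iff).2 hNo
  obtain ⟨z, hz⟩ := (hNt ▸ Submodule.mem_top : x ∈ N)
  exact ⟨z, z.2, hz⟩

end

/-- A subspace on which `V` restricts to an isomorphism onto the range of `V` is the graph of a
bounded operator. -/
theorem exists_angular_operator {V V' : H →L[ℂ] H} (hVV : V + V' = 1) {Z : Submodule ℂ H}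
    [CompleteSpace Z] [CompleteSpace (LinearMap.range V.toLinearMap)] {t : ℝ} (ht : 0 ≤ t)
    (hest : ∀ z ∈ Z, ‖V' z‖ ≤ t * ‖V z‖) (hsurj : ∀ x, ∃ z ∈ Z, V z = V x) :
    ∃ (Φ : Z ≃L[ℂ] LinearMap.range V.toLinearMap)
      (X : LinearMap.range V.toLinearMap →L[ℂ] LinearMap.range V'.toLinearMap),
      (∀ z : Z, (Φ z : H) = V z) ∧
      (∀ x : LinearMap.range V.toLinearMap, (X x : H) = V' (Φ.symm x : H)) ∧
      (Z : Set H) = {z | ∃ x : LinearMap.range V.toLinearMap, z = (x : H) + (X x : H)} ∧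
      ‖X‖ ≤ t := by
  have hsum : ∀ z, V z + V' z = z := fun z => congrArg (fun Y : H →L[ℂ] H => Y z) hVV
  let F : Z →L[ℂ] LinearMap.range V.toLinearMap :=
    (V.comp Z.subtypeL).codRestrict _ fun z => ⟨z, rfl⟩
  have hker : F.ker = ⊥ := by
    rw [LinearMap.ker_eq_bot']
    intro z hz
    have h0 : V z = 0 := congrArg Subtype.val hz
    have h1 := hest z z.2
    rw [h0, norm_zero, mul_zero] at h1
    apply Subtype.ext
    rw [← hsum z, h0, norm_le_zero_iff.1 h1, add_zero]
    rfl
  have hrange : F.range = ⊤ := by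
    rw [LinearMap.range_eq_top]
    rintro ⟨_, x, rfl⟩
    obtain ⟨z, hz, e⟩ := hsurj x
    exact ⟨⟨z, hz⟩, Subtype.ext e⟩
  let Φ := ContinuousLinearEquiv.ofBijective F hker hrange
  have hΦ : ∀ z : Z, (Φ z : H) = V z := fun z => rfl
  have hΦs : ∀ x, V (Φ.symm x : H) = x := fun x => by rw [← hΦ, Φ.apply_symm_apply]
  let X : LinearMap.range V.toLinearMap →L[ℂ] LinearMap.range V'.toLinearMap :=
    ((V'.comp Z.subtypeL).comp Φ.symm.toContinuousLinearMap).codRestrict _ fun x => ⟨_, rfl⟩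
  have hX : ∀ x, (X x : H) = V' (Φ.symm x : H) := fun x => rfl
  refine ⟨Φ, X, hΦ, hX, ?_, ?_⟩
  · ext z
    constructor
    · intro hz
      refine ⟨Φ ⟨z, hz⟩, ?_⟩
      rw [hX, Φ.symm_apply_apply, hΦ]
      exact (hsum z).symm
    · rintro ⟨x, rfl⟩
      have e : (x : H) + (X x : H) = (Φ.symm x : H) := by
        rw [hX]
        conv_lhs => rw [← hΦs x]
        exact hsum _
      rw [e]
      exact (Φ.symm x).2
  · refine ContinuousLinearMap.opNorm_le_bound _ ht fun x => ?_
    have := hest _ (Φ.symm x).2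
    rwa [hΦs] at this

/-- Angular operators of orthogonal subspaces with respect to an orthogonal decomposition. -/
theorem angular_operator_eq_neg_adjoint {R R' : Submodule ℂ H} [CompleteSpace R]
    [CompleteSpace R'] (X : R →L[ℂ] R') (Y : R' →L[ℂ] R)
    (hR : ∀ x ∈ R, ∀ y ∈ R', inner ℂ x y = 0)
    (h : ∀ (x : R) (y : R'), inner ℂ ((x : H) + X x) ((y : H) + Y y) = 0) :
    Y = -ContinuousLinearMap.adjoint X := by
  ext1 y
  refine ext_inner_left ℂ fun x => ?_
  -- Of the four terms only (x, Yy) and (Xx, y) survive the orthogonality of `R` and `R'`.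
  have := h x y
  rw [inner_add_left, inner_add_right, inner_add_right, hR x x.2 y y.2,
    ← inner_conj_symm (X x : H) (Y y : H), hR _ (Y y).2 _ (X x).2, map_zero, zero_add,
    add_zero] at this
  rw [neg_apply, inner_neg_right, ContinuousLinearMap.adjoint_inner_right]
  exact eq_neg_of_add_eq_zero_left this

/-! ### Positive and negative spectral subspaces -/

section

variable {T : H →ₗ.[ℂ] H}

theorem cfc_max_mul_cfc_max_neg (A : H →L[ℂ] H) :
    cfc (fun t : ℝ => max t 0) A * cfc (fun t : ℝ => max (-t) 0) A = 0 := by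
  rw [← cfc_mul _ _ _ (by fun_prop) (by fun_prop)]
  have : (fun t : ℝ => max t 0 * max (-t) 0) = fun _ => 0 := by
    ext t
    rcases le_total t 0 with h | h
    · rw [max_eq_right h, zero_mul]
    · rw [max_eq_right (neg_nonpos.2 h), mul_zero]
  rw [this, cfc_const_zero]

theorem mem_orthogonal_closure_range_iff {Y : H →L[ℂ] H} (hY : IsSelfAdjoint Y) (x : H) :
    x ∈ ((LinearMap.range Y.toLinearMap).topologicalClosure)ᗮ ↔ Y x = 0 := by
  rw [Submodule.orthogonal_closure, Submodule.mem_orthogonal]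
  constructor
  · intro h
    rw [← inner_self_eq_zero (𝕜 := ℂ)]
    have := h (Y (Y x)) ⟨_, rfl⟩
    rwa [← ContinuousLinearMap.adjoint_inner_right, hY.adjoint_eq] at this
  · rintro h _ ⟨y, rfl⟩
    change inner ℂ (Y y) x = 0
    rw [← ContinuousLinearMap.adjoint_inner_right, hY.adjoint_eq, h, inner_zero_right]

theorem mem_orthogonal_posSubspace_iff (x : H) :
    x ∈ (posSubspace T)ᗮ ↔ cfc (fun t : ℝ => max t 0) (boundedInverse T) x = 0 :=
  mem_orthogonal_closure_range_iff (cfc_predicate _ _) x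

theorem mem_orthogonal_negSubspace_iff (x : H) :
    x ∈ (negSubspace T)ᗮ ↔ cfc (fun t : ℝ => max (-t) 0) (boundedInverse T) x = 0 :=
  mem_orthogonal_closure_range_iff (cfc_predicate _ _) x

theorem negSubspace_le_orthogonal : negSubspace T ≤ (posSubspace T)ᗮ := by
  refine Submodule.topologicalClosure_minimal _ ?_ (Submodule.isClosed_orthogonal _)
  rintro _ ⟨y, rfl⟩
  rw [mem_orthogonal_posSubspace_iff]
  exact congrArg (fun Z : H →L[ℂ] H => Z y) (cfc_max_mul_cfc_max_neg (boundedInverse T))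

/-- A vector orthogonal to both spectral subspaces is annihilated by both parts of the inverse of
`T`, hence by the inverse itself; injectivity excludes a third summand. -/
theorem negSubspace_eq_orthogonal (hs : IsSelfAdjoint (boundedInverse T))
    (hi : Function.Injective (boundedInverse T)) : negSubspace T = (posSubspace T)ᗮ := by
  refine le_antisymm negSubspace_le_orthogonal fun x hx => ?_
  have hA : boundedInverse T = cfc (fun t : ℝ => max t 0) (boundedInverse T) -
      cfc (fun t : ℝ => max (-t) 0) (boundedInverse T) := by
    rw [← cfc_sub _ _ _ (by fun_prop) (by fun_prop)]
    conv_lhs => rw [← cfc_id' ℝ (boundedInverse T)]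
    refine cfc_congr fun t _ => ?_
    rcases le_total t 0 with h | h
    · simp [h]
    · simp [h]
  set w := x - negProj T x with hw
  have h1 : w ∈ (negSubspace T)ᗮ := Submodule.sub_starProjection_mem_orthogonal _
  have h2 : w ∈ (posSubspace T)ᗮ :=
    sub_mem hx (negSubspace_le_orthogonal (Submodule.starProjection_apply_mem _ _))
  have h3 : w = 0 := by
    apply hi
    rw [mem_orthogonal_posSubspace_iff] at h2
    rw [mem_orthogonal_negSubspace_iff] at h1
    rw [hA, sub_apply, h1, h2, sub_zero, map_zero]
  rw [sub_eq_zero.1 (hw.symm.trans h3)]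
  exact Submodule.starProjection_apply_mem _ _

theorem negProj_eq (hs : IsSelfAdjoint (boundedInverse T))
    (hi : Function.Injective (boundedInverse T)) : negProj T = 1 - posProj T := by
  have h : ∀ (W : Submodule ℂ H) [W.HasOrthogonalProjection], W = (posSubspace T)ᗮ →
      W.starProjection = 1 - posProj T := by
    rintro W _ rfl
    exact Submodule.starProjection_orthogonal' _
  exact h _ (negSubspace_eq_orthogonal hs hi)

theorem isSelfAdjoint_posProj : IsSelfAdjoint (posProj T) := isSelfAdjoint_starProjection _

theorem isIdempotentElem_posProj : IsIdempotentElem (posProj T) :=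
  Submodule.isIdempotentElem_starProjection _

/-- The projection need not be a continuous function of the inverse, so commutation is obtained from
the invariance of both spectral subspaces under `Y`. -/
theorem commute_posProj {Y : H →L[ℂ] H} (hY : Commute Y (boundedInverse T))
    (hs : IsSelfAdjoint (boundedInverse T)) (hi : Function.Injective (boundedInverse T)) (x : H) :
    posProj T (Y x) = Y (posProj T x) := by
  have hinv : ∀ f : ℝ → ℝ, ∀ z ∈ (LinearMap.range
      (cfc f (boundedInverse T) : H →L[ℂ] H).toLinearMap).topologicalClosure,
      Y z ∈ (LinearMap.range
        (cfc f (boundedInverse T) : H →L[ℂ] H).toLinearMap).topologicalClosure := by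
    intro f z hz
    rw [← SetLike.mem_coe, Submodule.topologicalClosure_coe] at hz ⊢
    refine closure_mono ?_ (image_closure_subset_closure_image Y.continuous ⟨z, hz, rfl⟩)
    rintro _ ⟨_, ⟨w, rfl⟩, rfl⟩
    refine ⟨Y w, ?_⟩
    exact congrArg (fun Z : H →L[ℂ] H => Z w) (hs.commute_cfc hY.symm f).eq
  have hp : Y (posProj T x) ∈ posSubspace T := hinv _ _ (Submodule.starProjection_apply_mem _ _)
  have hn : Y (negProj T x) ∈ negSubspace T := hinv _ _ (Submodule.starProjection_apply_mem _ _)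
  have hx : x = posProj T x + negProj T x := by
    rw [negProj_eq hs hi, sub_apply, one_apply_eq_self, add_sub_cancel]
  conv_lhs => rw [hx, map_add, map_add]
  have e1 : posProj T (Y (posProj T x)) = Y (posProj T x) :=
    Submodule.starProjection_eq_self_iff.2 hp
  have e2 : posProj T (Y (negProj T x)) = 0 :=
    (Submodule.starProjection_apply_eq_zero_iff _).2 (negSubspace_le_orthogonal hn)
  rw [e1, e2, add_zero]

theorem commute_absInvSqrt (hs : IsSelfAdjoint (boundedInverse T)) :
    Commute (absInvSqrt T) (boundedInverse T) :=
  hs.commute_cfc (Commute.refl _) _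

end

/-! ### Bounded sesquilinear forms -/

/-- For each fixed x the Riesz theorem gives a vector m(x), unique by density; the map m is then
linear and bounded, and extends by continuity. -/
theorem exists_operator_of_bounded {D : Submodule ℂ H} (hD : Dense (D : Set H)) (g : SesqForm D)
    {C : ℝ} (hC : ∀ x y : D, ‖g x y‖ ≤ C * ‖x‖ * ‖y‖) :
    ∃ M : H →L[ℂ] H, ∀ x y : D, g x y = inner ℂ (y : H) (M x) := by
  have hdr : DenseRange D.subtypeL := hD.denseRange_val
  have hui : IsUniformInducing D.subtypeL := isUniformEmbedding_subtype_val.isUniformInducing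
  have hex : ∀ x : D, ∃ m : H, ∀ y : D, g x y = inner ℂ (y : H) m := by
    intro x
    let ℓ : D →ₗ[ℂ] ℂ :=
      { toFun := fun y => starRingEnd ℂ (g x y)
        map_add' := fun y y' => by rw [map_add, map_add]
        map_smul' := fun c y => by simp }
    let L : D →L[ℂ] ℂ := ℓ.mkContinuous (C * ‖x‖) fun y => by
      change ‖starRingEnd ℂ (g x y)‖ ≤ _
      rw [RCLike.norm_conj]
      exact hC x y
    refine ⟨(InnerProductSpace.toDual ℂ H).symm (L.extend D.subtypeL), fun y => ?_⟩
    rw [← inner_conj_symm, InnerProductSpace.toDual_symm_apply]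
    have : L.extend D.subtypeL (y : H) = L y := L.extend_eq hdr hui y
    rw [this]
    exact (Complex.conj_conj _).symm
  choose m hm using hex
  have huniq : ∀ a b : H, (∀ y : D, inner ℂ (y : H) a = inner ℂ (y : H) b) → a = b :=
    fun a b h => hD.eq_of_inner_right ℂ fun y hy => h ⟨y, hy⟩
  let m' : D →ₗ[ℂ] H :=
    { toFun := m
      map_add' := fun x x' => huniq _ _ fun y => by
        rw [inner_add_right, ← hm, ← hm, ← hm, map_add, LinearMap.add_apply]
      map_smul' := fun c x => huniq _ _ fun y => by
        rw [RingHom.id_apply, inner_smul_right, ← hm, ← hm, map_smul, LinearMap.smul_apply,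
          smul_eq_mul] }
  have hbound : ∀ x, ‖m' x‖ ≤ C * ‖x‖ := by
    intro x
    -- The vector m x need not lie in `D`, so the bound is first carried to the closure and only
    -- then evaluated at m x.
    have hcl : IsClosed {y : H | ‖inner ℂ y (m x)‖ ≤ C * ‖x‖ * ‖y‖} :=
      isClosed_le (by fun_prop) (by fun_prop)
    have h1 : ‖inner ℂ (m x) (m x)‖ ≤ C * ‖x‖ * ‖m x‖ :=
      closure_minimal (fun y hy => by
        have := hC x ⟨y, hy⟩
        rw [hm] at this
        exact this) hcl (hD (m x))
    change ‖m x‖ ≤ C * ‖x‖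
    rcases eq_or_ne (m x) 0 with h0 | h0
    · have h2 := (norm_nonneg _).trans (hC x x)
      rw [h0, norm_zero]
      rcases (norm_nonneg x).eq_or_lt with hx | hx
      · rw [← hx, mul_zero]
      · exact nonneg_of_mul_nonneg_left h2 hx
    · rw [inner_self_eq_norm_sq_to_K] at h1
      have h3 : 0 < ‖m x‖ := norm_pos_iff.2 h0
      refine le_of_mul_le_mul_right ?_ h3
      calc ‖m x‖ * ‖m x‖ = ‖((‖m x‖ : ℂ)) ^ 2‖ := by simp [sq]
        _ ≤ _ := h1
  let M' : D →L[ℂ] H := m'.mkContinuous C hbound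
  refine ⟨M'.extend D.subtypeL, fun x y => ?_⟩
  have : M'.extend D.subtypeL (x : H) = M' x := M'.extend_eq hdr hui x
  rw [this]
  exact hm x y

/-- Homogeneity. Only invariance of `S` under scalars is required, because the union of the two
spectral subspaces is not a subspace. -/
theorem norm_form_le_of_weightedValues_le {T : H →ₗ.[ℂ] H} {D : Submodule ℂ H} (v : SesqForm D)
    {S : Set H} (hS : ∀ (c : ℂ), ∀ x ∈ S, c • x ∈ S) {C : ℝ} (hC : ∀ r ∈ weightedValues T v S, r ≤ C)
    {x y : H} (hxS : x ∈ S) (hyS : y ∈ S) (hx : absInvSqrt T x ∈ D) (hy : absInvSqrt T y ∈ D) :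
    ‖v ⟨absInvSqrt T x, hx⟩ ⟨absInvSqrt T y, hy⟩‖ ≤ C * ‖x‖ * ‖y‖ := by
  rcases eq_or_ne x 0 with rfl | hx0
  · have : (⟨absInvSqrt T 0, hx⟩ : D) = 0 := Subtype.ext (map_zero _)
    rw [this, map_zero, LinearMap.zero_apply]
    simp
  rcases eq_or_ne y 0 with rfl | hy0
  · have : (⟨absInvSqrt T 0, hy⟩ : D) = 0 := Subtype.ext (map_zero _)
    rw [this, map_zero]
    simp
  have hnx : 0 < ‖x‖ := norm_pos_iff.2 hx0
  have hny : 0 < ‖y‖ := norm_pos_iff.2 hy0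
  have key : ∀ (c : ℂ) (z : H) (hz : absInvSqrt T z ∈ D), ∃ h : absInvSqrt T (c • z) ∈ D,
      (⟨absInvSqrt T (c • z), h⟩ : D) = c • ⟨absInvSqrt T z, hz⟩ := by
    intro c z hz
    refine ⟨by rw [map_smul]; exact D.smul_mem _ hz, Subtype.ext (map_smul _ _ _)⟩
  obtain ⟨h1, e1⟩ := key ((‖x‖⁻¹ : ℝ) : ℂ) x hx
  obtain ⟨h2, e2⟩ := key ((‖y‖⁻¹ : ℝ) : ℂ) y hy
  have hn : ∀ z : H, z ≠ 0 → ‖((‖z‖⁻¹ : ℝ) : ℂ) • z‖ = 1 := by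
    intro z hz
    have : 0 < ‖z‖ := norm_pos_iff.2 hz
    rw [norm_smul, Complex.norm_real, norm_inv, norm_norm]
    field_simp
  have := hC _ ⟨_, hS _ _ hxS, _, hS _ _ hyS, hn x hx0, hn y hy0, h1, h2, rfl⟩
  rw [e1, e2, LinearMap.map_smulₛₗ, map_smul, LinearMap.smul_apply, norm_smul, norm_smul,
    RCLike.norm_conj, Complex.norm_real, Complex.norm_real, norm_inv, norm_inv, norm_norm,
    norm_norm, inv_mul_le_iff₀ hny, inv_mul_le_iff₀ hnx] at this
  linarith

section

variable {T : H →ₗ.[ℂ] H}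

theorem absSqrt_apply (hi : Function.Injective (absInvSqrt T)) (x : H)
    (h : absInvSqrt T x ∈ (absSqrt T).domain) : absSqrt T ⟨absInvSqrt T x, h⟩ = x :=
  invPMap_apply hi x h

theorem absInvSqrt_mem_domain (x : H) : absInvSqrt T x ∈ (absSqrt T).domain :=
  mem_domain_invPMap.2 ⟨x, rfl⟩

/-- The form `v[|T|^{-1/2} x, |T|^{-1/2} y]`. -/
def weightedForm (T : H →ₗ.[ℂ] H) {D : Submodule ℂ H} (v : SesqForm D) :
    SesqForm (D.comap (absInvSqrt T).toLinearMap) :=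
  let r := (absInvSqrt T).toLinearMap.restrict (p := D.comap (absInvSqrt T).toLinearMap) (q := D)
    fun _ hx => hx
  LinearMap.mk₂'ₛₗ (RingHom.id ℂ) (starRingEnd ℂ) (fun x y => v (r x) (r y))
    (fun x x' y => by rw [map_add, map_add, LinearMap.add_apply])
    (fun c x y => by rw [map_smul, map_smul, LinearMap.smul_apply]; rfl)
    (fun x y y' => by rw [map_add, map_add])
    (fun c x y => by rw [map_smul, LinearMap.map_smulₛₗ])

theorem exists_operator_of_weightedValues {D : Submodule ℂ H} (v : SesqForm D)
    (hd : Dense (D.comap (absInvSqrt T).toLinearMap : Set H))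
    (hb : BddAbove (weightedValues T v Set.univ)) :
    ∃ M : H →L[ℂ] H, ∀ x y (hx : absInvSqrt T x ∈ D) (hy : absInvSqrt T y ∈ D),
      v ⟨absInvSqrt T x, hx⟩ ⟨absInvSqrt T y, hy⟩ = inner ℂ y (M x) := by
  obtain ⟨C, hC⟩ := hb
  obtain ⟨M, hM⟩ := exists_operator_of_bounded hd (weightedForm T v) (C := C) fun x y =>
    norm_form_le_of_weightedValues_le v (fun _ _ _ => Set.mem_univ _) (fun r hr => hC hr)
      (Set.mem_univ _) (Set.mem_univ _) x.2 y.2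
  exact ⟨M, fun x y hx hy => hM ⟨x, hx⟩ ⟨y, hy⟩⟩

theorem exists_isFormExtension (hi : Function.Injective (absInvSqrt T)) {D : Submodule ℂ H}
    (v : SesqForm D) (hD : (absSqrt T).HasCore D) (hb : BddAbove (weightedValues T v Set.univ)) :
    ∃ w, IsFormExtension T v w := by
  obtain ⟨hle, hd⟩ := (hasCore_invPMap_iff hi D).1 hD
  obtain ⟨M, hM⟩ := exists_operator_of_weightedValues v hd hb
  let w : SesqForm (absSqrt T).domain :=
    LinearMap.mk₂'ₛₗ (RingHom.id ℂ) (starRingEnd ℂ)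
      (fun u w => inner ℂ (absSqrt T w) (M (absSqrt T u)))
      (fun u u' w => by rw [LinearPMap.map_add, map_add, inner_add_right])
      (fun c u w => by rw [LinearPMap.map_smul, map_smul, inner_smul_right]; rfl)
      (fun u w w' => by rw [LinearPMap.map_add, inner_add_left])
      (fun c u w => by rw [LinearPMap.map_smul, inner_smul_left]; rfl)
  have hw : ∀ x y hx hy, w ⟨absInvSqrt T x, hx⟩ ⟨absInvSqrt T y, hy⟩ = inner ℂ y (M x) := by
    intro x y hx hy
    change inner ℂ (absSqrt T ⟨absInvSqrt T y, hy⟩) (M (absSqrt T ⟨absInvSqrt T x, hx⟩)) = _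
    rw [absSqrt_apply hi, absSqrt_apply hi]
  refine ⟨w, ⟨‖M‖, ?_⟩, hle, fun u u' => ?_⟩
  · rintro _ ⟨x, -, y, -, hx1, hy1, hx, hy, rfl⟩
    rw [hw]
    refine (norm_inner_le_norm _ _).trans ?_
    rw [hy1, one_mul]
    simpa [hx1] using M.le_opNorm x
  · obtain ⟨x, hx⟩ := mem_domain_invPMap.1 (hle u.2)
    obtain ⟨y, hy⟩ := mem_domain_invPMap.1 (hle u'.2)
    obtain ⟨u, hu⟩ := u
    obtain ⟨u', hu'⟩ := u'
    simp only at hx hy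
    subst hx hy
    rw [hM]
    exact hw x y _ _

theorem formExtension_spec (hi : Function.Injective (absInvSqrt T)) {D : Submodule ℂ H}
    (v : SesqForm D) (hD : (absSqrt T).HasCore D) (hb : BddAbove (weightedValues T v Set.univ)) :
    IsFormExtension T v (formExtension T v) := by
  have h := exists_isFormExtension hi v hD hb
  rw [formExtension, dif_pos h]
  exact h.choose_spec

/-- The bounded self-adjoint operator representing a relatively bounded symmetric form. -/
theorem exists_operator_formExtension (hi : Function.Injective (absInvSqrt T)) {D : Submodule ℂ H}
    (v : SesqForm D) (hv : IsSymmForm v) (hD : (absSqrt T).HasCore D)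
    (hb : BddAbove (weightedValues T v Set.univ)) :
    ∃ M : H →L[ℂ] H, IsSelfAdjoint M ∧ ∀ x y hx hy,
      formExtension T v ⟨absInvSqrt T x, hx⟩ ⟨absInvSqrt T y, hy⟩ = inner ℂ y (M x) := by
  obtain ⟨hbw, hle, hext⟩ := formExtension_spec hi v hD hb
  have htop : (absSqrt T).domain.comap (absInvSqrt T).toLinearMap = ⊤ :=
    Submodule.eq_top_iff'.2 fun x => absInvSqrt_mem_domain x
  obtain ⟨M, hM⟩ := exists_operator_of_weightedValues (formExtension T v)
    (by rw [htop]; exact dense_univ) hbw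
  refine ⟨M, ?_, hM⟩
  have hd := ((hasCore_invPMap_iff hi D).1 hD).2
  have h1 : ∀ x y : H, absInvSqrt T x ∈ D → absInvSqrt T y ∈ D →
      inner ℂ y (M x) = inner ℂ (M y) x := by
    intro x y hx hy
    rw [← hM x y (hle hx) (hle hy), ← inner_conj_symm, ← hM y x (hle hy) (hle hx)]
    have e1 := hext ⟨_, hx⟩ ⟨_, hy⟩
    have e2 := hext ⟨_, hy⟩ ⟨_, hx⟩
    rw [hv] at e1
    exact e1.trans (congrArg _ e2.symm)
  -- The symmetry is known for both arguments in the dense preimage of `D` and is extended by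
  -- continuity in one variable at a time.
  have h2 : ∀ x y : H, absInvSqrt T x ∈ D → inner ℂ y (M x) = inner ℂ (M y) x := by
    intro x y hx
    have hcl : IsClosed {y : H | inner ℂ y (M x) = inner ℂ (M y) x} :=
      isClosed_eq (by fun_prop) (by fun_prop)
    exact closure_minimal (fun y hy => h1 x y hx hy) hcl (hd y)
  rw [ContinuousLinearMap.isSelfAdjoint_iff_isSymmetric]
  intro y x
  have hcl : IsClosed {x : H | inner ℂ y (M x) = inner ℂ (M y) x} :=
    isClosed_eq (by fun_prop) (by fun_prop)
  exact (closure_minimal (fun x hx => h2 x y hx) hcl (hd x)).symm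

end

/-! ### Off-diagonal and diagonal blocks -/

section

variable {U M : H →L[ℂ] H} {ρ : ℝ}

/-- The reflection `U - (1 - U)` belonging to a projection `U`. -/
def reflectionOp (U : H →L[ℂ] H) : H →L[ℂ] H := 2 • U - 1

theorem reflectionOp_apply (U : H →L[ℂ] H) (g : H) : reflectionOp U g = U g + U g - g := by
  rw [reflectionOp, sub_apply, smul_apply, one_apply_eq_self, two_smul]

theorem reflection_apply_apply (hU2 : IsIdempotentElem U) (g : H) :
    reflectionOp U (reflectionOp U g) = g := by
  have h : U (U g) = U g := congrArg (fun Z : H →L[ℂ] H => Z g) hU2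
  simp only [reflectionOp_apply, map_sub, map_add, h]
  abel

theorem isSelfAdjoint_reflection (hU : IsSelfAdjoint U) : IsSelfAdjoint (reflectionOp U) := by
  rw [isSelfAdjoint_iff, reflectionOp, star_sub, star_nsmul, hU.star_eq, star_one]

theorem norm_reflection_apply (hU : IsSelfAdjoint U) (hU2 : IsIdempotentElem U) (g : H) :
    ‖reflectionOp U g‖ = ‖g‖ := by
  have h : inner ℂ (reflectionOp U g) (reflectionOp U g) = inner ℂ g g := by
    rw [← ContinuousLinearMap.adjoint_inner_right, (isSelfAdjoint_reflection hU).adjoint_eq,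
      reflection_apply_apply hU2]
  rw [inner_self_eq_norm_sq_to_K, inner_self_eq_norm_sq_to_K] at h
  have h' : ‖reflectionOp U g‖ ^ 2 = ‖g‖ ^ 2 := by exact_mod_cast h
  exact (sq_eq_sq₀ (norm_nonneg _) (norm_nonneg _)).1 h'

theorem re_inner_reflection (hU : IsSelfAdjoint U) (hU2 : IsIdempotentElem U) (g : H) :
    RCLike.re (inner ℂ g (reflectionOp U g)) = ‖U g‖ ^ 2 - ‖g - U g‖ ^ 2 := by
  have h : U (U g) = U g := congrArg (fun Z : H →L[ℂ] H => Z g) hU2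
  have h1 : inner ℂ g (U g) = inner ℂ (U g) (U g) := by
    rw [← ContinuousLinearMap.adjoint_inner_right, hU.adjoint_eq, h]
  rw [reflectionOp_apply, inner_sub_right, inner_add_right, h1,
    map_sub, map_add, inner_self_eq_norm_sq, inner_self_eq_norm_sq]
  have := norm_sq_add_norm_sub_sq hU hU2 g
  linarith

/-- The form inequalities behind the estimate of the angle. -/
theorem block_estimate (hU : IsSelfAdjoint U) (hU2 : IsIdempotentElem U) (hM : IsSelfAdjoint M)
    (hρ0 : 0 ≤ ρ) (hρ1 : ρ < 1)
    (hb : ∀ x y, (U x = x ∨ U x = 0) → (U y = y ∨ U y = 0) →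
      ‖inner ℂ y (M x)‖ ≤ ρ * ‖x‖ * ‖y‖) (g : H) :
    (1 - ρ) * ‖g‖ ^ 2 ≤ RCLike.re (inner ℂ (reflectionOp U g) ((reflectionOp U + M) g)) ∧
    (1 - ρ) * |RCLike.re (inner ℂ g ((reflectionOp U + M) g))| ≤
      RCLike.re (inner ℂ (reflectionOp U g) ((reflectionOp U + M) g)) := by
  have hUU : U (U g) = U g := congrArg (fun Z : H →L[ℂ] H => Z g) hU2
  set p := U g with hp
  set n := g - U g with hn
  have hg : g = p + n := by rw [hn, add_sub_cancel]
  have hJ : reflectionOp U g = p - n := by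
    rw [reflectionOp_apply, hn, ← hp]
    abel
  have hp' : U p = p ∨ U p = 0 := Or.inl hUU
  have hn' : U n = n ∨ U n = 0 := Or.inr (by rw [hn, map_sub, ← hp, hUU, sub_self])
  have hre : ∀ x y, (U x = x ∨ U x = 0) → (U y = y ∨ U y = 0) →
      |RCLike.re (inner ℂ y (M x))| ≤ ρ * ‖x‖ * ‖y‖ := fun x y hx hy =>
    (RCLike.abs_re_le_norm _).trans (hb x y hx hy)
  have hpp := abs_le.1 (hre p p hp' hp')
  have hnn := abs_le.1 (hre n n hn' hn')
  have hpn := abs_le.1 (hre p n hp' hn')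
  have hsw := re_inner_apply_swap hM p n
  have hpy : ‖n‖ ^ 2 + ‖p‖ ^ 2 = ‖g‖ ^ 2 := norm_sq_add_norm_sub_sq hU hU2 g
  -- The off-diagonal terms cancel here, since the reflection changes the sign of n and M is
  -- self-adjoint.
  have e1 : RCLike.re (inner ℂ (reflectionOp U g) ((reflectionOp U + M) g)) =
      ‖g‖ ^ 2 + RCLike.re (inner ℂ p (M p)) - RCLike.re (inner ℂ n (M n)) := by
    rw [add_apply, inner_add_right, map_add, inner_self_eq_norm_sq, norm_reflection_apply hU hU2,
      hJ, hg, map_add M, inner_sub_left, inner_add_right, inner_add_right, map_sub, map_add,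
      map_add, hsw]
    ring
  have e2 : RCLike.re (inner ℂ g ((reflectionOp U + M) g)) =
      ‖p‖ ^ 2 - ‖n‖ ^ 2 + RCLike.re (inner ℂ p (M p)) + RCLike.re (inner ℂ n (M n)) +
        2 * RCLike.re (inner ℂ n (M p)) := by
    rw [add_apply, inner_add_right, map_add, re_inner_reflection hU hU2, ← hn, ← hp]
    nth_rewrite 1 2 [hg]
    rw [map_add M, inner_add_left, inner_add_right, inner_add_right, map_add, map_add,
      map_add, hsw]
    ring
  have abs_scale : ∀ s, (1 - ρ) * |s| = |(1 - ρ) * s| := fun s => by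
    rw [abs_mul, abs_of_nonneg (by linarith : 0 ≤ 1 - ρ)]
  have h0 : 0 ≤ ρ * (‖p‖ - ‖n‖) ^ 2 := by positivity
  have hc : 0 ≤ 1 - ρ := by linarith
  rw [e1, e2]
  set m := RCLike.re (inner ℂ p (M p))
  set k := RCLike.re (inner ℂ n (M n))
  set r := RCLike.re (inner ℂ n (M p))
  refine ⟨by nlinarith, ?_⟩
  -- For the upper bound, right side minus left side is at least (1 - ρ)(ρ(‖p‖ - ‖n‖)² + 2(1 -
  -- ρ)‖n‖²); for the lower bound the last square is ‖p‖². The facts below are the pieces of these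
  -- two expressions.
  have hcr1 : (1 - ρ) * r ≤ (1 - ρ) * (ρ * ‖p‖ * ‖n‖) := by gcongr; exact hpn.2
  have hcr2 : (1 - ρ) * (-(ρ * ‖p‖ * ‖n‖)) ≤ (1 - ρ) * r := by gcongr; exact hpn.1
  have a1 : 0 ≤ ρ * (m + ρ * ‖p‖ * ‖p‖) := mul_nonneg hρ0 (by linarith)
  have a2 : 0 ≤ (2 - ρ) * (m + ρ * ‖p‖ * ‖p‖) := mul_nonneg (by linarith) (by linarith)
  have b1 : 0 ≤ ρ * (ρ * ‖n‖ * ‖n‖ - k) := mul_nonneg hρ0 (by linarith)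
  have b2 : 0 ≤ (2 - ρ) * (ρ * ‖n‖ * ‖n‖ - k) := mul_nonneg (by linarith) (by linarith)
  have c1 : 0 ≤ (1 - ρ) * (ρ * (‖p‖ - ‖n‖) ^ 2) := mul_nonneg hc h0
  have d1 : 0 ≤ (1 - ρ) ^ 2 * ‖p‖ ^ 2 := by positivity
  have d2 : 0 ≤ (1 - ρ) ^ 2 * ‖n‖ ^ 2 := by positivity
  rw [abs_scale, abs_le]
  constructor <;> nlinarith

/-- Equivalently cos 2θ = 1 - ρ, which is how the factor 1 - ρ in `block_estimate` encodes the
angle. -/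
theorem sin_arctan_sqrt (hρ0 : 0 ≤ ρ) (hρ1 : ρ < 1) :
    Real.sin (Real.arctan (√(ρ / (2 - ρ)))) = √(ρ / 2) := by
  have h2 : 0 < 2 - ρ := by linarith
  rw [Real.sin_arctan, Real.sq_sqrt (by positivity), ← Real.sqrt_div' _ (by positivity)]
  congr 1
  field_simp
  ring

theorem norm_le_of_re_inner (hU : IsSelfAdjoint U) (hU2 : IsIdempotentElem U) (hρ0 : 0 ≤ ρ)
    (hρ1 : ρ < 1) {z : H} (h : (1 - ρ) * ‖z‖ ^ 2 ≤ RCLike.re (inner ℂ z (reflectionOp U z))) :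
    ‖z - U z‖ ≤ Real.sin (Real.arctan (√(ρ / (2 - ρ)))) * ‖z‖ := by
  rw [re_inner_reflection hU hU2] at h
  have := norm_sq_add_norm_sub_sq hU hU2 z
  rw [sin_arctan_sqrt hρ0 hρ1]
  refine abs_le_of_sq_le_sq' ?_ (by positivity) |>.2
  rw [mul_pow, Real.sq_sqrt (by positivity)]
  linarith

end

/-! ### The operator associated with the form sum -/

section

variable {T : H →ₗ.[ℂ] H}

theorem signOp_eq (hs : IsSelfAdjoint (boundedInverse T))
    (hi : Function.Injective (boundedInverse T)) : signOp T = reflectionOp (posProj T) := by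
  rw [signOp, reflectionOp, negProj_eq hs hi, two_smul]
  abel

/-- For Bz = Rx with Sx = Rz one has q[Rx, Ry] = (Sx, y) = (Rz, y) = (z, Ry). The adjoint clause
follows in the same way because B⁻¹ and S are self-adjoint. -/
theorem isAssociated_invPMap {R S B : H →L[ℂ] H} {D : Submodule ℂ H} (q : SesqForm D)
    (hR : IsSelfAdjoint R) (hS : IsSelfAdjoint S) (hB : IsSelfAdjoint B)
    (hBi : Function.Injective B) (hD : ∀ u, u ∈ D ↔ ∃ x, R x = u)
    (hq : ∀ x y hx hy, q ⟨R x, hx⟩ ⟨R y, hy⟩ = inner ℂ y (S x))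
    (hRSB : ∀ w, ∃ x, B w = R x ∧ S x = R w) : IsAssociated (invPMap B) q := by
  have hT := isSelfAdjoint_invPMap hB hBi
  have hle : (invPMap B).domain ≤ D := by
    intro u hu
    obtain ⟨w, rfl⟩ := mem_domain_invPMap.1 hu
    obtain ⟨x, e, -⟩ := hRSB w
    exact (hD _).2 ⟨x, e.symm⟩
  have hRs : ∀ x y, inner ℂ (R x) y = inner ℂ x (R y) := fun x y => by
    rw [← ContinuousLinearMap.adjoint_inner_right, hR.adjoint_eq]
  have hSs : ∀ x y, inner ℂ (S x) y = inner ℂ x (S y) := fun x y => by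
    rw [← ContinuousLinearMap.adjoint_inner_right, hS.adjoint_eq]
  refine ⟨isClosed_invPMap hBi, dense_domain_invPMap hB hBi, ⟨hle, ?_⟩, ?_⟩
  · rintro ⟨u, hu⟩ ⟨w, hw⟩
    obtain ⟨y, rfl⟩ := (hD _).1 hw
    obtain ⟨z, rfl⟩ := mem_domain_invPMap.1 hu
    obtain ⟨x, e, e'⟩ := hRSB z
    rw [invPMap_apply hBi]
    have : Submodule.inclusion hle ⟨B z, hu⟩ = ⟨R x, (hD _).2 ⟨x, rfl⟩⟩ := Subtype.ext e
    rw [this, hq, e']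
    exact hRs _ _
  · rw [LinearPMap.isSelfAdjoint_def.1 hT]
    refine ⟨hle, ?_⟩
    rintro ⟨w, hw⟩ ⟨u, hu⟩
    obtain ⟨y, rfl⟩ := (hD _).1 hw
    obtain ⟨z, rfl⟩ := mem_domain_invPMap.1 hu
    obtain ⟨x, e, e'⟩ := hRSB z
    rw [invPMap_apply hBi]
    have : Submodule.inclusion hle ⟨B z, hu⟩ = ⟨R x, (hD _).2 ⟨x, rfl⟩⟩ := Subtype.ext e
    rw [this, hq, ← hSs, e', hRs]

/-- The form identity and the injectivity of `S` force T' ⊆ B⁻¹; taking adjoints reverses the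
inclusion between the two self-adjoint operators. -/
theorem eq_invPMap_of_isAssociated {R S B : H →L[ℂ] H} {D : Submodule ℂ H} (q : SesqForm D)
    (hR : IsSelfAdjoint R) (hB : IsSelfAdjoint B) (hBi : Function.Injective B)
    (hSi : Function.Injective S) (hD : ∀ u, u ∈ D ↔ ∃ x, R x = u)
    (hq : ∀ x y hx hy, q ⟨R x, hx⟩ ⟨R y, hy⟩ = inner ℂ y (S x))
    (hRSB : ∀ w, ∃ x, B w = R x ∧ S x = R w) {T' : H →ₗ.[ℂ] H} (hT' : IsSelfAdjoint T')
    (hA : IsAssociated T' q) : T' = invPMap B := by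
  have hT := isSelfAdjoint_invPMap hB hBi
  obtain ⟨-, hd, ⟨hle, h⟩, -⟩ := hA
  have hle' : T' ≤ invPMap B := by
    apply LinearPMap.le_of_le_graph
    rintro ⟨_, _⟩ hp
    obtain ⟨⟨u, hu⟩, rfl, rfl⟩ := (LinearPMap.mem_graph_iff _).1 hp
    rw [mem_graph_invPMap hBi]
    obtain ⟨x, rfl⟩ := (hD _).1 (hle hu)
    obtain ⟨x', e, e'⟩ := hRSB (T' ⟨R x, hu⟩)
    change B (T' ⟨R x, hu⟩) = R x
    rw [e]
    congr 1
    apply hSi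
    rw [e']
    refine ext_inner_left ℂ fun y => ?_
    have h1 := h ⟨R x, hu⟩ ⟨R y, (hD _).2 ⟨y, rfl⟩⟩
    have h2 : Submodule.inclusion hle ⟨R x, hu⟩ = ⟨R x, (hD _).2 ⟨x, rfl⟩⟩ := rfl
    rw [h2, hq] at h1
    rw [← h1, ← ContinuousLinearMap.adjoint_inner_left, hR.adjoint_eq]
  refine le_antisymm hle' ?_
  have hf : (T').IsFormalAdjoint (invPMap B) := by
    have h1 := LinearPMap.adjoint_isFormalAdjoint hT.dense_domain
    rw [LinearPMap.isSelfAdjoint_def.1 hT] at h1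
    intro x y
    rw [hle'.2 (x := x) (y := ⟨x, hle'.1 x.2⟩) rfl]
    exact h1 _ _
  have := hf.le_adjoint hd
  rwa [LinearPMap.isSelfAdjoint_def.1 hT'] at this

end

/-! ### Spectral subspaces of the operator associated with the form sum -/

/-- The spectral subspaces of `B⁻¹`, where `B = R S⁻¹ R` and `S = J + M`, make a small angle with
those of the reflection `J`. -/
theorem norm_le_of_mem_spectral_subspaces {U M R B : H →L[ℂ] H} {ρ : ℝ} (hU : IsSelfAdjoint U)
    (hU2 : IsIdempotentElem U) (hM : IsSelfAdjoint M) (hρ0 : 0 ≤ ρ) (hρ1 : ρ < 1)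
    (hb : ∀ x y, (U x = x ∨ U x = 0) → (U y = y ∨ U y = 0) →
      ‖inner ℂ y (M x)‖ ≤ ρ * ‖x‖ * ‖y‖)
    (hR : IsSelfAdjoint R) (hUR : ∀ x, U (R x) = R (U x)) (hB : IsSelfAdjoint B)
    (hRSB : ∀ w, ∃ x, B w = R x ∧ (reflectionOp U + M) x = R w) :
    (∀ z ∈ (LinearMap.range
      (cfc (fun t : ℝ => max t 0) B : H →L[ℂ] H).toLinearMap).topologicalClosure,
      ‖z - U z‖ ≤ Real.sin (Real.arctan (√(ρ / (2 - ρ)))) * ‖z‖) ∧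
    ∀ z ∈ (LinearMap.range
      (cfc (fun t : ℝ => max (-t) 0) B : H →L[ℂ] H).toLinearMap).topologicalClosure,
      ‖U z‖ ≤ Real.sin (Real.arctan (√(ρ / (2 - ρ)))) * ‖z‖ := by
  set J := reflectionOp U with hJ
  have hJs : IsSelfAdjoint J := isSelfAdjoint_reflection hU
  have hRs : ∀ x y, inner ℂ x (R y) = inner ℂ (R x) y := fun x y => by
    rw [← ContinuousLinearMap.adjoint_inner_left, hR.adjoint_eq]
  -- With Bw = Rx and Sx = Rw, moving R across the scalar product turns quadratic expressions in B
  -- at w into expressions in S at x.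
  have hform : ∀ w, ∃ x, RCLike.re (inner ℂ w (J (B w))) =
      RCLike.re (inner ℂ (J x) ((J + M) x)) ∧
      RCLike.re (inner ℂ w (B w)) = RCLike.re (inner ℂ x ((J + M) x)) := by
    intro w
    obtain ⟨x, e, e'⟩ := hRSB w
    refine ⟨x, ?_, ?_⟩
    · have : J (R x) = R (J x) := by
        rw [hJ, reflectionOp_apply, reflectionOp_apply, map_sub, map_add, hUR]
      rw [e, this, hRs, e', ← inner_conj_symm, RCLike.conj_re]
    · rw [e, hRs, e', ← inner_conj_symm, RCLike.conj_re]
  have hcs : IsSelfAdjoint ((1 - ρ) • (1 : H →L[ℂ] H)) := (IsSelfAdjoint.all (1 - ρ)).smul (.one _)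
  have hcre : ∀ x y : H, RCLike.re (inner ℂ x (((1 - ρ) • (1 : H →L[ℂ] H)) y)) =
      (1 - ρ) * RCLike.re (inner ℂ x y) := by
    intro x y
    rw [smul_apply, one_apply_eq_self, inner_smul_right_eq_smul, RCLike.smul_re]
  have hest := fun w => block_estimate hU hU2 hM hρ0 hρ1 hb w
  constructor
  · intro z hz
    refine norm_le_of_re_inner hU hU2 hρ0 hρ1 ?_
    have := re_inner_nonneg_of_mem_closure_range_posPart (K := J - (1 - ρ) • 1) hB (hJs.sub hcs)
      (fun w => by
        obtain ⟨x, e1, e2⟩ := hform w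
        have h1 := (hest x).2
        have h2 := mul_le_mul_of_nonneg_left
          (le_abs_self (RCLike.re (inner ℂ x ((J + M) x)))) (by linarith : 0 ≤ 1 - ρ)
        rw [sub_apply, inner_sub_right, map_sub, hcre, e1, e2]
        linarith) hz
    rw [sub_apply, inner_sub_right, map_sub, hcre, inner_self_eq_norm_sq] at this
    linarith
  · intro z hz
    -- The negative part of B is the positive part of -B, and 1 - U has the reflection -J; the other
    -- sign in the absolute value of `block_estimate` is used.
    have hU1 : IsSelfAdjoint (1 - U) := (IsSelfAdjoint.one _).sub hU
    have hJ1 : reflectionOp (1 - U) = -J := by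
      rw [hJ, reflectionOp, reflectionOp, two_smul, two_smul]
      abel
    have key : ‖z - (1 - U) z‖ ≤ Real.sin (Real.arctan (√(ρ / (2 - ρ)))) * ‖z‖ := by
      refine norm_le_of_re_inner hU1 hU2.one_sub hρ0 hρ1 ?_
      rw [hJ1]
      have hz' : z ∈ (LinearMap.range
          (cfc (fun t : ℝ => max t 0) (-B) : H →L[ℂ] H).toLinearMap).topologicalClosure := by
        rwa [← cfc_comp_neg (fun t : ℝ => max t 0) B]
      have := re_inner_nonneg_of_mem_closure_range_posPart (K := -J - (1 - ρ) • 1) hB.neg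
        (hJs.neg.sub hcs)
        (fun w => by
          obtain ⟨x, e1, e2⟩ := hform w
          have h1 := (hest x).2
          have h2 := mul_le_mul_of_nonneg_left
            (neg_abs_le (RCLike.re (inner ℂ x ((J + M) x)))) (by linarith : 0 ≤ 1 - ρ)
          rw [sub_apply, inner_sub_right, map_sub, hcre]
          simp only [neg_apply, map_neg, inner_neg_right, neg_neg]
          rw [e1, e2]
          linarith) hz'
      rw [sub_apply, inner_sub_right, map_sub, hcre, inner_self_eq_norm_sq] at this
      linarith
    simpa using key

end

end FormSum

/-! ### Construction of the operator and of its angular operators -/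

theorem theorem3p2 {H : Type*} [NormedAddCommGroup H] [InnerProductSpace ℂ H] [CompleteSpace H]
    (H₀ : H →ₗ.[ℂ] H) (hH₀ : IsSelfAdjoint H₀)
    (δ : ℝ) (hδ : 0 < δ) (hgap : HasSpectralGap H₀ (-δ) δ)
    (D : Submodule ℂ H) (v : SesqForm D) (hv : IsSymmForm v) (hD : (absSqrt H₀).HasCore D)
    (hbdd : BddAbove (weightedValues H₀ v Set.univ))
    (ρ : ℝ)
    (hρ : ρ = sSup (weightedValues H₀ (formExtension H₀ v)
      ((posSubspace H₀ : Set H) ∪ (negSubspace H₀ : Set H))))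
    (hρ1 : ρ < 1)
    (P : ComplProj H) (ν : ℝ) (hν : ν = ‖posProj H₀ - P.pos‖) (hν1 : ν < 1)
    (hangle : Real.arctan (√(ρ / (2 - ρ))) + Real.arcsin ν < Real.pi / 2) :
    ∃ T : H →ₗ.[ℂ] H,
      -- `T` is the unique self-adjoint operator associated with the form sum
      (IsSelfAdjoint T ∧ IsAssociated T (reprForm H₀ + formExtension H₀ v)) ∧
      (∀ T' : H →ₗ.[ℂ] H, IsSelfAdjoint T' →
        IsAssociated T' (reprForm H₀ + formExtension H₀ v) → T' = T) ∧
      (0 : ℂ) ∈ resSet T ∧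
      (absSqrt H₀).HasCore T.domain ∧
      -- the restrictions of the projections to the spectral subspaces of `T` are isomorphisms
      ∃ (Φp : posSubspace T ≃L[ℂ] P.posRange) (Φm : negSubspace T ≃L[ℂ] P.negRange)
        (Xp : P.posRange →L[ℂ] P.negRange) (Xm : P.negRange →L[ℂ] P.posRange),
        (∀ x : posSubspace T, (Φp x : H) = P.pos x) ∧
        (∀ y : negSubspace T, (Φm y : H) = P.neg y) ∧
        (∀ x : P.posRange, (Xp x : H) = P.neg (Φp.symm x : H)) ∧
        (∀ y : P.negRange, (Xm y : H) = P.pos (Φm.symm y : H)) ∧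
        (posSubspace T : Set H) = {z | ∃ x : P.posRange, z = (x : H) + (Xp x : H)} ∧
        (negSubspace T : Set H) = {z | ∃ y : P.negRange, z = (y : H) + (Xm y : H)} ∧
        ‖Xp‖ ≤ Real.tan (Real.arctan (√(ρ / (2 - ρ))) + Real.arcsin ν) ∧
        ‖Xm‖ ≤ Real.tan (Real.arctan (√(ρ / (2 - ρ))) + Real.arcsin ν) ∧
        (IsSelfAdjoint P.pos → Xm = -ContinuousLinearMap.adjoint Xp) := by
  have h0 : (0 : ℂ) ∈ resSet H₀ := by
    have := hgap 0 ⟨by linarith, hδ⟩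
    simpa using this
  have hAs := isSelfAdjoint_boundedInverse hH₀ h0
  have hAi := injective_boundedInverse hH₀ h0
  have hRi := injective_absInvSqrt hH₀ h0
  have hR := isSelfAdjoint_absInvSqrt H₀
  set R := absInvSqrt H₀ with hRdef
  obtain ⟨M, hM, hMv⟩ := exists_operator_formExtension hRi v hv hD hbdd
  obtain ⟨hbw, -⟩ := formExtension_spec hRi v hD hbdd
  set U := posProj H₀ with hUdef
  have hU : IsSelfAdjoint U := isSelfAdjoint_posProj
  have hU2 : IsIdempotentElem U := isIdempotentElem_posProj
  have hUn : negProj H₀ = 1 - U := negProj_eq hAs hAi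
  have hρ0 : 0 ≤ ρ := by
    rw [hρ]
    refine Real.sSup_nonneg ?_
    rintro _ ⟨x, -, y, -, -, -, hx, hy, rfl⟩
    exact norm_nonneg _
  have hle : ∀ r ∈ weightedValues H₀ (formExtension H₀ v)
      ((posSubspace H₀ : Set H) ∪ (negSubspace H₀ : Set H)), r ≤ ρ := by
    intro r hr
    rw [hρ]
    -- Boundedness of the extension is essential here: the real supremum of an unbounded set is 0 by
    -- convention and bounds nothing.
    refine le_csSup (hbw.mono ?_) hr
    rintro _ ⟨x, -, y, -, h⟩
    exact ⟨x, Set.mem_univ _, y, Set.mem_univ _, h⟩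
  have hmem : ∀ x, (U x = x ∨ U x = 0) →
      x ∈ (posSubspace H₀ : Set H) ∪ (negSubspace H₀ : Set H) := by
    rintro x (h | h)
    · exact Or.inl (Submodule.starProjection_eq_self_iff.1 h)
    · refine Or.inr ?_
      rw [negSubspace_eq_orthogonal hAs hAi]
      exact (Submodule.starProjection_apply_eq_zero_iff _).1 h
  have hb : ∀ x y, (U x = x ∨ U x = 0) → (U y = y ∨ U y = 0) →
      ‖inner ℂ y (M x)‖ ≤ ρ * ‖x‖ * ‖y‖ := by
    intro x y hx hy
    rw [← hMv x y (absInvSqrt_mem_domain x) (absInvSqrt_mem_domain y)]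
    refine norm_form_le_of_weightedValues_le _ ?_ hle (hmem x hx) (hmem y hy) _ _
    rintro c z (hz | hz)
    · exact Or.inl (Submodule.smul_mem _ c hz)
    · exact Or.inr (Submodule.smul_mem _ c hz)
  set S := reflectionOp U + M with hSdef
  have hSs : IsSelfAdjoint S := (isSelfAdjoint_reflection hU).add hM
  have hSu : IsUnit S := isUnit_of_coercive S (reflectionOp U)
    (fun x => (norm_reflection_apply hU hU2 x).le) (by linarith : 0 < 1 - ρ)
    (fun x => (block_estimate hU hU2 hM hρ0 hρ1 hb x).1) hSs
  obtain ⟨Su, hSu⟩ := hSu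
  set S' : H →L[ℂ] H := ↑Su⁻¹ with hS'
  have hSS' : S * S' = 1 := by rw [← hSu, hS', Units.mul_inv]
  have hS'S : S' * S = 1 := by rw [← hSu, hS', Units.inv_mul]
  have hS's : IsSelfAdjoint S' := by
    have h1 : star S' * S = 1 := by
      have := congrArg star hSS'
      rwa [star_mul, hSs.star_eq, star_one] at this
    exact left_inv_eq_right_inv h1 hSS'
  have hSi : Function.Injective S := Function.LeftInverse.injective (g := S')
    fun x => congrArg (fun Z : H →L[ℂ] H => Z x) hS'S
  have hS'i : Function.Injective S' := Function.LeftInverse.injective (g := S)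
    fun x => congrArg (fun Z : H →L[ℂ] H => Z x) hSS'
  have hS'surj : Function.Surjective S' :=
    fun x => ⟨S x, congrArg (fun Z : H →L[ℂ] H => Z x) hS'S⟩
  set B : H →L[ℂ] H := R * S' * R with hBdef
  have hB : IsSelfAdjoint B := by
    rw [isSelfAdjoint_iff, hBdef, star_mul, star_mul, hR.star_eq, hS's.star_eq, mul_assoc]
  have hBi : Function.Injective B := hRi.comp (hS'i.comp hRi)
  have hRSB : ∀ w, ∃ x, B w = R x ∧ S x = R w := fun w =>
    ⟨S' (R w), rfl, congrArg (fun Z : H →L[ℂ] H => Z (R w)) hSS'⟩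
  have hdom : ∀ u, u ∈ (absSqrt H₀).domain ↔ ∃ x, R x = u := fun u => mem_domain_invPMap
  have hq : ∀ x y hx hy, (reprForm H₀ + formExtension H₀ v) ⟨R x, hx⟩ ⟨R y, hy⟩ =
      inner ℂ y (S x) := by
    intro x y hx hy
    have h1 : reprForm H₀ ⟨R x, hx⟩ ⟨R y, hy⟩ = inner ℂ y (reflectionOp U x) := by
      change inner ℂ (signOp H₀ (absSqrt H₀ ⟨R y, hy⟩)) (absSqrt H₀ ⟨R x, hx⟩) = _
      rw [absSqrt_apply hRi, absSqrt_apply hRi, signOp_eq hAs hAi,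
        ← ContinuousLinearMap.adjoint_inner_right, (isSelfAdjoint_reflection hU).adjoint_eq]
    rw [LinearMap.add_apply, LinearMap.add_apply, h1, hMv, hSdef, add_apply, inner_add_right]
  have hbT : boundedInverse (invPMap B) = B := boundedInverse_invPMap hBi
  refine ⟨invPMap B, ⟨isSelfAdjoint_invPMap hB hBi,
    isAssociated_invPMap _ hR hSs hB hBi hdom hq hRSB⟩,
    fun T' hT' hA => eq_invPMap_of_isAssociated _ hR hB hBi hSi hdom hq hRSB hT' hA,
    zero_mem_resSet_invPMap hBi, ?_, ?_⟩
  · refine (hasCore_invPMap_iff hRi _).2 ⟨?_, ?_⟩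
    · intro u hu
      obtain ⟨w, rfl⟩ := mem_domain_invPMap.1 hu
      exact (hdom _).2 ⟨S' (R w), rfl⟩
    · have hd : DenseRange (S' ∘ R) :=
        hS'surj.denseRange.comp (dense_range_of_injective hR hRi) S'.continuous
      refine hd.mono ?_
      rintro _ ⟨w, rfl⟩
      exact mem_domain_invPMap.2 ⟨w, rfl⟩
  have hneg : negSubspace (invPMap B) = (posSubspace (invPMap B))ᗮ :=
    negSubspace_eq_orthogonal (by rwa [hbT]) (by rwa [hbT])
  have hcp : IsClosed (posSubspace (invPMap B) : Set H) := Submodule.isClosed_topologicalClosure _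
  have hcn : IsClosed (negSubspace (invPMap B) : Set H) := Submodule.isClosed_topologicalClosure _
  have hpos : posSubspace (invPMap B) = (negSubspace (invPMap B))ᗮ := by
    rw [hneg, Submodule.orthogonal_orthogonal]
  obtain ⟨hzp, hzn⟩ := norm_le_of_mem_spectral_subspaces hU hU2 hM hρ0 hρ1 hb hR
    (fun x => commute_posProj (commute_absInvSqrt hAs) hAs hAi x) hB hRSB
  rw [← hbT] at hzp hzn
  change ∀ z ∈ posSubspace (invPMap B), _ at hzp
  change ∀ z ∈ negSubspace (invPMap B), _ at hzn
  have hν0 : 0 ≤ ν := by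
    rw [hν]
    exact norm_nonneg _
  set θ := Real.arctan (√(ρ / (2 - ρ))) with hθ
  have hθ0 : 0 ≤ θ := Real.arctan_nonneg.2 (Real.sqrt_nonneg _)
  have hφ0 : 0 ≤ Real.arcsin ν := Real.arcsin_nonneg.2 hν0
  have ht : 0 ≤ Real.tan (θ + Real.arcsin ν) :=
    Real.tan_nonneg_of_nonneg_of_le_pi_div_two (by linarith) hangle.le
  have hUV : ‖U - P.pos‖ ≤ Real.sin (Real.arcsin ν) := by
    rw [Real.sin_arcsin (by linarith) hν1.le, hν]
  have hPn : P.neg = 1 - P.pos := eq_sub_of_add_eq' P.add_eq_one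
  have hUV' : ‖(1 - U) - P.neg‖ ≤ Real.sin (Real.arcsin ν) := by
    have : (1 - U) - P.neg = -(U - P.pos) := by
      rw [hPn]
      abel
    rwa [this, norm_neg]
  have hU' : IsSelfAdjoint (1 - U) := (IsSelfAdjoint.one _).sub hU
  have hsub : ∀ z, (z : H) - (1 - U) z = U z := fun z => by simp
  have hPsub : ∀ z, (z : H) - P.pos z = P.neg z := fun z => by simp [hPn]
  have hPsub' : ∀ z, (z : H) - P.neg z = P.pos z := fun z => by simp [hPn]
  have : CompleteSpace (LinearMap.range P.pos.toLinearMap) :=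
    inferInstanceAs (CompleteSpace P.posRange)
  have : CompleteSpace (LinearMap.range P.neg.toLinearMap) :=
    inferInstanceAs (CompleteSpace P.negRange)
  -- The orthogonal complement of the positive subspace is the negative one, so the angle bound for
  -- each subspace supplies the surjectivity condition for the other.
  obtain ⟨Φp, Xp, hΦp, hXp, hgp, hnp⟩ := exists_angular_operator
    (V := P.pos) (V' := P.neg) (Z := posSubspace (invPMap B)) P.add_eq_one ht
    (fun z hz => by
      rw [← hPsub]
      exact norm_sub_oblique_le hU hU2 P.idem_pos hθ0 hφ0 hangle hUV (hzp z hz))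
    (exists_oblique_apply_eq hU hU2 P.idem_pos hθ0 hφ0 hangle hUV hcp hzp
      (by rwa [← hneg]))
  obtain ⟨Φm, Xm, hΦm, hXm, hgm, hnm⟩ := exists_angular_operator
    (V := P.neg) (V' := P.pos) (Z := negSubspace (invPMap B))
    ((add_comm _ _).trans P.add_eq_one) ht
    (fun z hz => by
      rw [← hPsub']
      exact norm_sub_oblique_le hU' hU2.one_sub P.idem_neg hθ0 hφ0 hangle hUV'
        (by rw [hsub]; exact hzn z hz))
    (exists_oblique_apply_eq hU' hU2.one_sub P.idem_neg hθ0 hφ0 hangle hUV' hcn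
      (fun z hz => by rw [hsub]; exact hzn z hz)
      (by
        rw [← hpos]
        exact fun z hz => by simpa using hzp z hz))
  refine ⟨Φp, Φm, Xp, Xm, hΦp, hΦm, hXp, hXm, hgp, hgm, hnp, hnm, fun hPs => ?_⟩
  refine angular_operator_eq_neg_adjoint Xp Xm ?_ fun x y => ?_
  · rintro _ ⟨x, rfl⟩ _ ⟨y, rfl⟩
    change inner ℂ (P.pos x) (P.neg y) = 0
    have h : P.pos (P.neg y) = 0 := by
      have : P.pos (P.pos y) = P.pos y := congrArg (fun Z : H →L[ℂ] H => Z y) P.idem_pos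
      rw [hPn, sub_apply, one_apply_eq_self, map_sub, this, sub_self]
    rw [← ContinuousLinearMap.adjoint_inner_right, hPs.adjoint_eq, h, inner_zero_right]
  · have h1 : (x : H) + Xp x ∈ posSubspace (invPMap B) := by
      rw [← SetLike.mem_coe, hgp]
      exact ⟨x, rfl⟩
    have h2 : (y : H) + Xm y ∈ negSubspace (invPMap B) := by
      rw [← SetLike.mem_coe, hgm]
      exact ⟨y, rfl⟩
    rw [hneg] at h2
    exact Submodule.inner_right_of_mem_orthogonal h1 h2
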